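/- Let ${\mathsf K},{\mathsf U},{\mathsf S}$ be integers with $1\le {\mathsf U}<{\mathsf K}$ and $1\le {\mathsf S}\le {\mathsf K}$, let $\mathbb{F}_{\mathsf q}$ be any finite field, write $[{\mathsf K}]=\{1,\dots,{\mathsf K}\}$ and $\binom{[{\mathsf K}]}{{\mathsf S}}$ for the family of ${\mathsf S}$-element subsets of $[{\mathsf K}]$, and let all entropies be in base ${\mathsf q}$. The $({\mathsf K},{\mathsf U},{\mathsf S})$ information-theoretic secure aggregation problem with uncoded groupwise keys is the following. For an input length ${\mathsf L}\ge 1$, a *scheme* consists of random variables with finite alphabets on a common probability space: - inputs $W_1,\dots,W_{\mathsf K}$, each uniform on $\mathbb{F}_{\mathsf q}^{\mathsf L}$; - keys $Z_{\mathcal V}$, ${\mathcal V}\in\binom{[{\mathsf K}]}{{\mathsf S}}$, such that all keys and inputs are mutually independent, i.e. $H\big((Z_{\mathcal V})_{\mathcal V},(W_k)_k\big)=\sum_{\mathcal V}H(Z_{\mathcal V})+\sum_k H(W_k)$; put $Z_k:=(Z_{\mathcal V}: k\in{\mathcal V})$; - first-round messages $X_k$, $k\in[{\mathsf K}]$, with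 $H(X_k\mid W_k,Z_k)=0$; - for every ${\mathcal U}_1\subseteq[{\mathsf K}]$ with $|{\mathcal U}_1|\ge{\mathsf U}$ and every $k\in{\mathcal U}_1$, a second-round message $Y_k^{{\mathcal U}_1}$ with $H(Y_k^{{\mathcal U}_1}\mid W_k,Z_k)=0$; which satisfy - decodability: $H\big(\sum_{k\in{\mathcal U}_1}W_k \,\big|\, (X_k)_{k\in{\mathcal U}_1},(Y_k^{{\mathcal U}_1})_{k\in{\mathcal U}_2}\big)=0$ for all ${\mathcal U}_2\subseteq{\mathcal U}_1\subseteq[{\mathsf K}]$ with $|{\mathcal U}_2|\ge{\mathsf U}$; - security: $I\big(W_1,\dots,W_{\mathsf K};\, X_1,\dots,X_{\mathsf K},(Y_k^{{\mathcal U}_1})_{k\in{\mathcal U}_1} \,\big|\, \sum_{k\in{\mathcal U}_1}W_k\big)=0$ for all ${\mathcal U}_1\subseteq[{\mathsf K}]$ with $|{\mathcal U}_1|\ge{\mathsf U}$. The rates of a scheme are ${\mathsf R}_1=\max_{k\in[{\mathsf K}]}H(X_k)/{\mathsf L}$ and ${\mathsf R}_2=\max_{|{\mathcal U}_1|\ge{\mathsf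 U}}\max_{k\in{\mathcal U}_1}H(Y_k^{{\mathcal U}_1})/{\mathsf L}$. A pair $({\mathsf R}_1,{\mathsf R}_2)$ is achievable if it is the pair of rates of some scheme for some ${\mathsf L}\ge1$, and the capacity region ${\mathcal R}^\star\subseteq\mathbb{R}^2$ is the closure of the set of achievable pairs. **Theorem.** If ${\mathsf S}=1$, secure aggregation is impossible: no scheme exists for any ${\mathsf L}\ge 1$. If ${\mathsf S}\ge2$, then $$ {\mathcal R}^{\star}=\left\{({\mathsf R}_1,{\mathsf R}_2)\in\mathbb{R}^2:\ {\mathsf R}_1\ge\frac{\binom{{\mathsf K}-1}{{\mathsf S}-1}}{\binom{{\mathsf K}-1}{{\mathsf S}-1}-\binom{{\mathsf K}-1-{\mathsf U}}{{\mathsf S}-1}},\quad {\mathsf R}_2\ge\frac1{\mathsf U}\right\}, $$ where $\binom{n}{m}=0$ for $n<m$. -/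

import Mathlib

namespace SecureAggregation

open MeasureTheory

universe u

section Entropy

variable {Ω α β γ : Type*} [MeasurableSpace Ω] [Fintype α] [Fintype β] [Fintype γ]

/-- Shannon entropy, in base `b`, of a random variable `A` with finite alphabet:
`-∑ a, P(A = a) log_b P(A = a)`. -/
noncomputable def entropy (b : ℝ) (μ : Measure Ω) (A : Ω → α) : ℝ :=
  ∑ a, Real.negMulLog (μ.real (A ⁻¹' {a})) / Real.log b

/-- Conditional entropy `H(A | B) = H(A, B) - H(B)`. -/
noncomputable def condEntropy (b : ℝ) (μ : Measure Ω) (A : Ω → α) (B : Ω → β) : ℝ :=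
  entropy b μ (fun ω => (A ω, B ω)) - entropy b μ B

/-- Conditional mutual information `I(A ; B | C) = H(A | C) - H(A | B, C)`. -/
noncomputable def condMutualInfo (b : ℝ) (μ : Measure Ω)
    (A : Ω → α) (B : Ω → β) (C : Ω → γ) : ℝ :=
  condEntropy b μ A C - condEntropy b μ A (fun ω => (B ω, C ω))

end Entropy

/-- The groups of exactly `S` users among the `K` users. -/
abbrev UserGroup (K S : ℕ) : Type := {V : Finset (Fin K) // V.card = S}

/-- The random variables of a two-round aggregation protocol with `K` users, groups of size `S`
and input vectors of `L` symbols of `F`, all on one probability space. The alphabets of the keys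
and of the messages are arbitrary finite sets. `Y U₁ k` is the second-round message of user `k`
when `U₁` is the set of users surviving the first round; it is meaningful only for `k ∈ U₁`, and
no constraint or rate below refers to its other values. -/
structure Scheme (K S L : ℕ) (F : Type u) where
  Ω : Type u
  [measΩ : MeasurableSpace Ω]
  μ : Measure Ω
  [probμ : IsProbabilityMeasure μ]
  Key : UserGroup K S → Type u
  [fintypeKey : ∀ V, Fintype (Key V)]
  Msg₁ : Fin K → Type u
  [fintypeMsg₁ : ∀ k, Fintype (Msg₁ k)]
  Msg₂ : Finset (Fin K) → Fin K → Type u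
  [fintypeMsg₂ : ∀ U₁ k, Fintype (Msg₂ U₁ k)]
  /-- the input vectors -/
  W : Fin K → Ω → (Fin L → F)
  /-- the groupwise keys -/
  Z : (V : UserGroup K S) → Ω → Key V
  /-- the first-round messages -/
  X : (k : Fin K) → Ω → Msg₁ k
  /-- the second-round messages -/
  Y : (U₁ : Finset (Fin K)) → (k : Fin K) → Ω → Msg₂ U₁ k
  measurable_W : ∀ k, Measurable[measΩ, ⊤] (W k)
  measurable_Z : ∀ V, Measurable[measΩ, ⊤] (Z V)
  measurable_X : ∀ k, Measurable[measΩ, ⊤] (X k)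
  measurable_Y : ∀ U₁ k, Measurable[measΩ, ⊤] (Y U₁ k)

attribute [instance] Scheme.measΩ Scheme.probμ Scheme.fintypeKey Scheme.fintypeMsg₁
  Scheme.fintypeMsg₂

namespace Scheme

variable {K S L : ℕ} {F : Type u} [Field F] [Fintype F] (𝒮 : Scheme K S L F)

/-- Entropy in base `q = |F|`. -/
noncomputable def H {α : Type*} [Fintype α] (A : 𝒮.Ω → α) : ℝ :=
  entropy (Fintype.card F) 𝒮.μ A

/-- Conditional entropy in base `q = |F|`. -/
noncomputable def condH {α β : Type*} [Fintype α] [Fintype β]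
    (A : 𝒮.Ω → α) (B : 𝒮.Ω → β) : ℝ :=
  condEntropy (Fintype.card F) 𝒮.μ A B

/-- Conditional mutual information in base `q = |F|`. -/
noncomputable def condI {α β γ : Type*} [Fintype α] [Fintype β] [Fintype γ]
    (A : 𝒮.Ω → α) (B : 𝒮.Ω → β) (C : 𝒮.Ω → γ) : ℝ :=
  condMutualInfo (Fintype.card F) 𝒮.μ A B C

/-- The tuple `Z_k` of all keys held by user `k`. -/
def userKeys (k : Fin K) (ω : 𝒮.Ω) (V : {V : UserGroup K S // k ∈ V.1}) : 𝒮.Key V.1 :=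
  𝒮.Z V.1 ω

/-- The sum of the input vectors of the users in `U₁`. -/
def sumInputs (U₁ : Finset (Fin K)) (ω : 𝒮.Ω) : Fin L → F :=
  ∑ k ∈ U₁, 𝒮.W k ω

/-- Each `W_k` consists of `L` i.i.d. uniform symbols of `F`, i.e. is uniform on `F ^ L`. -/
def UniformInputs : Prop :=
  ∀ (k : Fin K) (w : Fin L → F),
    𝒮.μ.real (𝒮.W k ⁻¹' {w}) = 1 / (Fintype.card F : ℝ) ^ L

/-- All keys and all input vectors are mutually independent. -/
def IndependentKeys : Prop :=
  𝒮.H (fun ω => ((fun V => 𝒮.Z V ω), (fun k => 𝒮.W k ω)))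
    = ∑ V, 𝒮.H (𝒮.Z V) + ∑ k, 𝒮.H (𝒮.W k)

/-- `X_k` is determined by `(W_k, Z_k)`. -/
def FirstRoundEncoding : Prop :=
  ∀ k : Fin K, 𝒮.condH (𝒮.X k) (fun ω => (𝒮.W k ω, 𝒮.userKeys k ω)) = 0

/-- For each possible surviving set `U₁`, the message of `k ∈ U₁` is determined by
`(W_k, Z_k)`. -/
def SecondRoundEncoding (U : ℕ) : Prop :=
  ∀ U₁ : Finset (Fin K), U ≤ U₁.card → ∀ k ∈ U₁,
    𝒮.condH (𝒮.Y U₁ k) (fun ω => (𝒮.W k ω, 𝒮.userKeys k ω)) = 0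

/-- The server recovers the sum over `U₁` from the first-round messages of `U₁` and the
second-round messages of `U₂`. -/
def Decodable (U : ℕ) : Prop :=
  ∀ U₁ U₂ : Finset (Fin K), U₂ ⊆ U₁ → U ≤ U₂.card →
    𝒮.condH (𝒮.sumInputs U₁)
      (fun ω => ((fun k : U₁ => 𝒮.X k ω), (fun k : U₂ => 𝒮.Y U₁ k ω))) = 0

/-- All messages together reveal nothing about the inputs beyond the sum over `U₁`. -/
def Secure (U : ℕ) : Prop :=
  ∀ U₁ : Finset (Fin K), U ≤ U₁.card →
    𝒮.condI (fun ω k => 𝒮.W k ω)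
      (fun ω => ((fun k => 𝒮.X k ω), (fun k : U₁ => 𝒮.Y U₁ k ω)))
      (𝒮.sumInputs U₁) = 0

/-- The scheme solves the secure aggregation problem with uncoded groupwise keys in which at
least `U` users survive. -/
structure IsSecureAggregation (U : ℕ) : Prop where
  uniform : 𝒮.UniformInputs
  keys : 𝒮.IndependentKeys
  encode₁ : 𝒮.FirstRoundEncoding
  encode₂ : 𝒮.SecondRoundEncoding U
  decode : 𝒮.Decodable U
  secure : 𝒮.Secure U

/-- First-round rate: the maximum over the users `k` of `H(X_k) / L`. -/
noncomputable def rate₁ : ℝ :=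
  ⨆ k : Fin K, 𝒮.H (𝒮.X k) / L

/-- Second-round rate: the maximum of `H(Y_k^{U₁}) / L` over the sets `U₁` of at least `U` users
and the users `k ∈ U₁`. -/
noncomputable def rate₂ (U : ℕ) : ℝ :=
  ⨆ p : {p : Finset (Fin K) × Fin K // U ≤ p.1.card ∧ p.2 ∈ p.1},
    𝒮.H (𝒮.Y p.1.1 p.1.2) / L

end Scheme

/-- Secure aggregation is possible, for some input length `L ≥ 1`. -/
def Possible (K U S : ℕ) (F : Type u) [Field F] [Fintype F] : Prop :=
  ∃ L : ℕ, 0 < L ∧ ∃ 𝒮 : Scheme K S L F, 𝒮.IsSecureAggregation U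

/-- `R = (R₁, R₂)` is the rate tuple of some scheme, for some input length `L ≥ 1`. -/
def Achievable (K U S : ℕ) (F : Type u) [Field F] [Fintype F] (R : ℝ × ℝ) : Prop :=
  ∃ L : ℕ, 0 < L ∧ ∃ 𝒮 : Scheme K S L F,
    𝒮.IsSecureAggregation U ∧ R.1 = 𝒮.rate₁ ∧ R.2 = 𝒮.rate₂ U

/-- The capacity region: the closure of the set of achievable rate tuples. -/
def capacityRegion (K U S : ℕ) (F : Type u) [Field F] [Fintype F] : Set (ℝ × ℝ) :=
  closure {R | Achievable K U S F R}

end SecureAggregation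

/-! Converse, first round. Fix a user k. For any U users U₂ not containing k, the sum over U₂ and k
must be decodable when k drops out after the first round. Hence X_k and the keys that k shares with
U₂ determine W_k (`Scheme.H_input_message_keys_le`), whereas X_k alone is independent of W_k by
security (`Scheme.masking`). So, given (W_k, X_k), the keys of k that meet U₂ lose at least L
symbols of entropy, while all keys of k together lose at most H(X_k). Every group through k meets
the same number of sets U₂, so `shearer`, applied to conditional key entropy, compares the two
losses (`Scheme.H_message_bound`). For S = 1 the resulting bound reads L ≤ 0.

Converse, second round. Let U₁ have exactly U members and let j lie outside. The first-round
messages must stay secure when j survives too, in which case W_j hides the sum over U₁. They are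
therefore independent of that sum, and the U second-round messages must supply all L symbols
(`Scheme.le_sum_H_second`).

Achievability. Put K = U + r + 1 and work over a large finite extension E of F. The input of a user
is read as U alternating (S-1)-forms on E^(U+r) that vanish on the last r coordinate directions.
Such forms have dimension d = C(K-1, S-1) - C(K-1-U, S-1), the denominator of the rate. User j is
given a Vandermonde vector a_j, any K-1 of which form a basis. For each group V through k, user k
sends the values of its forms on the vectors of V \ {k}, masked by a key of V; this costs C(K-1,
S-1) shares of U symbols for an input of dU symbols.

For j ≠ k, the contraction of a form of k by a_j is determined by its shares in the groups
containing both users, because the a_i with i ≠ k form a basis. So j knows the masks hiding the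
contraction by a_j of everyone's input. In the second round it releases d combinations of the
contracted sum, corrected by these masks. The combinations of any U users determine the sum when
their coefficients are generic: for one set of users, suitable coefficients come from an even
distribution of the unknowns (`exists_even_assignment`), and nonvanishing of a product of
polynomials treats all sets at once. Given the sum, the second-round messages are functions of the
uniformly masked first-round ones, whence security.

Finally, keys are sent as padding to raise both rates in steps of 1/L. With L arbitrarily large this
fills the whole quadrant after closure. -/

namespace SecureAggregation

open MeasureTheory Module

universe u

/-! ### Shannon inequalities for finite alphabets. -/

section EntropyInequalities

set_option linter.unusedSectionVars false

variable {Ω α β γ : Type*} [MeasurableSpace Ω] [Fintype α] [Fintype β] [Fintype γ]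

/-- All fibres of `A` are measurable events. -/
def MeasurableFibers (A : Ω → α) : Prop := ∀ a, MeasurableSet (A ⁻¹' {a})

lemma measurableFibers_of_measurable {A : Ω → α} (h : Measurable[_, ⊤] A) :
    MeasurableFibers A := fun a =>
  h (t := {a}) trivial

lemma MeasurableFibers.comp {A : Ω → α} (hA : MeasurableFibers A) (f : α → γ) :
    MeasurableFibers (fun ω => f (A ω)) := by
  intro c
  have : (fun ω => f (A ω)) ⁻¹' {c} = ⋃ a ∈ {a | f a = c}, A ⁻¹' {a} := by
    ext ω; simp
  rw [this]
  exact MeasurableSet.biUnion (Set.to_countable _) fun a _ => hA a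

lemma MeasurableFibers.prodMk {A : Ω → α} {B : Ω → β} (hA : MeasurableFibers A)
    (hB : MeasurableFibers B) : MeasurableFibers (fun ω => (A ω, B ω)) := by
  rintro ⟨a, b⟩
  have : (fun ω => (A ω, B ω)) ⁻¹' {(a, b)} = A ⁻¹' {a} ∩ B ⁻¹' {b} := by
    ext ω; simp
  rw [this]
  exact (hA a).inter (hB b)

lemma MeasurableFibers.pi {ι : Type*} [Fintype ι] [DecidableEq ι] {κ : ι → Type*}
    [∀ i, Fintype (κ i)] {A : ∀ i, Ω → κ i} (hA : ∀ i, MeasurableFibers (A i)) :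
    MeasurableFibers (fun ω i => A i ω) := by
  intro a
  have : (fun ω i => A i ω) ⁻¹' {a} = ⋂ i, A i ⁻¹' {a i} := by
    ext ω; simp [funext_iff]
  rw [this]
  exact MeasurableSet.iInter fun i => hA i (a i)

variable {μ : Measure Ω} [IsProbabilityMeasure μ]

open Classical in
lemma measureReal_comp_preimage {A : Ω → α} (hA : MeasurableFibers A) (f : α → γ) (c : γ) :
    μ.real ((fun ω => f (A ω)) ⁻¹' {c}) = ∑ a, if f a = c then μ.real (A ⁻¹' {a}) else 0 := by
  have : (fun ω => f (A ω)) ⁻¹' {c} = ⋃ a ∈ Finset.univ.filter (fun a => f a = c), A ⁻¹' {a} := by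
    ext ω; simp
  rw [this, measureReal_biUnion_finset, Finset.sum_filter]
  · intro a _ b _ hab
    exact Set.disjoint_iff_inter_eq_empty.2 (by
      ext ω; simp only [Set.mem_inter_iff, Set.mem_preimage, Set.mem_singleton_iff,
        Set.mem_empty_iff_false, iff_false, not_and]
      intro h h'; exact hab (h.symm.trans h'))
  · exact fun a _ => hA a

lemma sum_measureReal_preimage {A : Ω → α} (hA : MeasurableFibers A) :
    ∑ a, μ.real (A ⁻¹' {a}) = 1 := by
  classical
  have := measureReal_comp_preimage (μ := μ) hA (fun _ => ()) ()
  simpa using this.symm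

/-- Each log p_i is at most the logarithm of the sum. This is why merging atoms lowers entropy. -/
lemma negMulLog_sum_le {ι : Type*} (s : Finset ι) (p : ι → ℝ) (hp : ∀ i, 0 ≤ p i) :
    Real.negMulLog (∑ i ∈ s, p i) ≤ ∑ i ∈ s, Real.negMulLog (p i) := by
  rw [Real.negMulLog, ← Finset.sum_neg_distrib, Finset.sum_mul]
  refine Finset.sum_le_sum fun i hi => ?_
  rw [Real.negMulLog]
  rcases (hp i).eq_or_lt with h | h
  · simp [← h]
  · have : Real.log (p i) ≤ Real.log (∑ i ∈ s, p i) :=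
      Real.log_le_log h (Finset.single_le_sum (fun j _ => hp j) hi)
    nlinarith

variable {b : ℝ}

lemma entropy_comp_le (hb : 1 ≤ b) {A : Ω → α} (hA : MeasurableFibers A) (f : α → γ) :
    entropy b μ (fun ω => f (A ω)) ≤ entropy b μ A := by
  classical
  unfold entropy
  rw [← Finset.sum_div, ← Finset.sum_div]
  refine div_le_div_of_nonneg_right ?_ (Real.log_nonneg hb)
  calc ∑ c, Real.negMulLog (μ.real ((fun ω => f (A ω)) ⁻¹' {c}))
      ≤ ∑ c, ∑ a, if f a = c then Real.negMulLog (μ.real (A ⁻¹' {a})) else 0 := by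
        refine Finset.sum_le_sum fun c _ => ?_
        rw [measureReal_comp_preimage hA, ← Finset.sum_filter, ← Finset.sum_filter]
        exact negMulLog_sum_le _ _ fun _ => measureReal_nonneg
    _ = ∑ a, Real.negMulLog (μ.real (A ⁻¹' {a})) := by
        rw [Finset.sum_comm]; simp

lemma entropy_const (a : α) : entropy b μ (fun _ : Ω => a) = 0 := by
  classical
  refine Finset.sum_eq_zero fun c _ => ?_
  by_cases h : a = c <;> simp [h]

/-- The pointwise Gibbs inequality. -/
lemma mul_log_ratio_le {p x : ℝ} (hp : 0 ≤ p) (hx : 0 ≤ x) (h : 0 < p → 0 < x) :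
    p * (Real.log x - Real.log p) ≤ x - p := by
  rcases hp.eq_or_lt with h0 | h0
  · simp [← h0, hx]
  · have hx' := h h0
    rw [← Real.log_div hx'.ne' h0.ne']
    have := Real.log_le_sub_one_of_pos (div_pos hx' h0)
    calc p * Real.log (x / p) ≤ p * (x / p - 1) := by gcongr
      _ = x - p := by field_simp

lemma entropy_le_log_card (hb : 1 ≤ b) {A : Ω → α} (hA : MeasurableFibers A) :
    entropy b μ A ≤ Real.log (Fintype.card α) / Real.log b := by
  unfold entropy
  rw [← Finset.sum_div]
  refine div_le_div_of_nonneg_right ?_ (Real.log_nonneg hb)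
  have h1 := sum_measureReal_preimage (μ := μ) hA
  have hn : (0 : ℝ) < Fintype.card α := by
    rcases isEmpty_or_nonempty α with h | h
    · simp at h1
    · exact_mod_cast Fintype.card_pos
  have key : ∀ a, Real.negMulLog (μ.real (A ⁻¹' {a})) ≤
      μ.real (A ⁻¹' {a}) * Real.log (Fintype.card α) +
        ((Fintype.card α : ℝ)⁻¹ - μ.real (A ⁻¹' {a})) := by
    intro a
    have := mul_log_ratio_le (p := μ.real (A ⁻¹' {a})) (x := (Fintype.card α : ℝ)⁻¹)
      measureReal_nonneg (by positivity) (fun _ => by positivity)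
    rw [Real.log_inv] at this
    rw [Real.negMulLog]; linarith
  refine (Finset.sum_le_sum fun a _ => key a).trans ?_
  rw [Finset.sum_add_distrib, Finset.sum_sub_distrib, ← Finset.sum_mul, h1]
  simp [hn.ne']

/-- Strong subadditivity: `H(A, B) + H(C) ≤ H(A) + H(B)` whenever `C` is a function of `A` and
also a function of `B`. -/
theorem entropy_submodular (hb : 1 ≤ b) {A : Ω → α} {B : Ω → β} (hA : MeasurableFibers A)
    (hB : MeasurableFibers B) (f : α → γ) (g : β → γ) (hfg : ∀ ω, f (A ω) = g (B ω)) :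
    entropy b μ (fun ω => (A ω, B ω)) + entropy b μ (fun ω => f (A ω)) ≤
      entropy b μ A + entropy b μ B := by
  classical
  unfold entropy
  simp only [← Finset.sum_div, ← add_div]
  refine div_le_div_of_nonneg_right ?_ (Real.log_nonneg hb)
  have hAB := hA.prodMk hB
  set p : α × β → ℝ := fun x => μ.real ((fun ω => (A ω, B ω)) ⁻¹' {x}) with hp
  set pA : α → ℝ := fun a => μ.real (A ⁻¹' {a}) with hpA
  set pB : β → ℝ := fun a => μ.real (B ⁻¹' {a}) with hpB
  set pC : γ → ℝ := fun c => μ.real ((fun ω => f (A ω)) ⁻¹' {c}) with hpC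
  have p0 : ∀ x, 0 ≤ p x := fun _ => measureReal_nonneg
  have pA0 : ∀ x, 0 ≤ pA x := fun _ => measureReal_nonneg
  have pB0 : ∀ x, 0 ≤ pB x := fun _ => measureReal_nonneg
  have pC0 : ∀ x, 0 ≤ pC x := fun _ => measureReal_nonneg
  have hAsum : ∀ a, pA a = ∑ b, p (a, b) := by
    intro a
    have := measureReal_comp_preimage (μ := μ) hAB Prod.fst a
    rw [Fintype.sum_prod_type] at this
    refine this.trans ?_
    rw [Finset.sum_eq_single a]
    · simp [hp]
    · intro a' _ h; simp [h]
    · simp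
  have hBsum : ∀ b, pB b = ∑ a, p (a, b) := by
    intro b
    have := measureReal_comp_preimage (μ := μ) hAB Prod.snd b
    rw [Fintype.sum_prod_type_right] at this
    refine this.trans ?_
    rw [Finset.sum_eq_single b]
    · simp [hp]
    · intro a' _ h; simp [h]
    · simp
  have hCA : ∀ c, pC c = ∑ a, if f a = c then pA a else 0 :=
    fun c => measureReal_comp_preimage (μ := μ) hA f c
  have hCB : ∀ c, pC c = ∑ a, if g a = c then pB a else 0 := by
    intro c
    have := measureReal_comp_preimage (μ := μ) hB g c
    simpa only [hpC, hfg] using this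
  have hsupp : ∀ a b, f a ≠ g b → p (a, b) = 0 := by
    intro a b h
    have : (fun ω => (A ω, B ω)) ⁻¹' {(a, b)} = ∅ := by
      ext ω
      simp only [Set.mem_preimage, Set.mem_singleton_iff, Prod.mk.injEq, Set.mem_empty_iff_false,
        iff_false, not_and]
      rintro rfl rfl; exact h (hfg ω)
    simp [hp, this]
  have hleA : ∀ a b, p (a, b) ≤ pA a := fun a b => by
    rw [hAsum]; exact Finset.single_le_sum (fun b _ => p0 (a, b)) (Finset.mem_univ b)
  have hleB : ∀ a b, p (a, b) ≤ pB b := fun a b => by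
    rw [hBsum]; exact Finset.single_le_sum (fun a _ => p0 (a, b)) (Finset.mem_univ a)
  have hleC : ∀ a, pA a ≤ pC (f a) := fun a => by
    rw [hCA]
    have := Finset.single_le_sum (f := fun a' => if f a' = f a then pA a' else 0)
      (fun a' _ => by split_ifs; exacts [pA0 _, le_rfl]) (Finset.mem_univ a)
    simpa using this
  have eA : ∑ a, Real.negMulLog (pA a) = ∑ a, ∑ b, -(p (a, b) * Real.log (pA a)) := by
    refine Finset.sum_congr rfl fun a _ => ?_
    rw [Real.negMulLog, Finset.sum_neg_distrib, ← Finset.sum_mul, ← hAsum]; ring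
  have eB : ∑ b, Real.negMulLog (pB b) = ∑ a, ∑ b, -(p (a, b) * Real.log (pB b)) := by
    rw [Finset.sum_comm]
    refine Finset.sum_congr rfl fun b _ => ?_
    rw [Real.negMulLog, Finset.sum_neg_distrib, ← Finset.sum_mul, ← hBsum]; ring
  have eC : ∑ c, Real.negMulLog (pC c) = ∑ a, ∑ b, -(p (a, b) * Real.log (pC (f a))) := by
    have h1 : ∀ a, ∑ b, -(p (a, b) * Real.log (pC (f a))) = -(pA a * Real.log (pC (f a))) := by
      intro a; rw [Finset.sum_neg_distrib, ← Finset.sum_mul, ← hAsum]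
    simp only [h1]
    have h2 : ∀ c, Real.negMulLog (pC c) =
        ∑ a, if f a = c then -(pA a * Real.log (pC (f a))) else 0 := by
      intro c
      have : ∀ a, (if f a = c then -(pA a * Real.log (pC (f a))) else 0) =
          -((if f a = c then pA a else 0) * Real.log (pC c)) := by
        intro a; split_ifs with h <;> simp [h]
      simp only [this]
      rw [Finset.sum_neg_distrib, ← Finset.sum_mul, ← hCA, Real.negMulLog]; ring
    simp only [h2]
    rw [Finset.sum_comm]; simp
  have eAB : ∑ x, Real.negMulLog (p x) = ∑ a, ∑ b, -(p (a, b) * Real.log (p (a, b))) := by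
    rw [Fintype.sum_prod_type]
    simp [Real.negMulLog]
  -- `q` is the law under which A and B are conditionally independent given C. The claim is the
  -- Gibbs inequality for `p` against `q`, for which total mass of `q` at most 1 suffices.
  set q : α → β → ℝ := fun a b => if f a = g b then pA a * pB b / pC (f a) else 0 with hq
  have hterm : ∀ a b, -(p (a, b) * Real.log (p (a, b))) + -(p (a, b) * Real.log (pC (f a))) -
      (-(p (a, b) * Real.log (pA a)) + -(p (a, b) * Real.log (pB b))) ≤ q a b - p (a, b) := by
    intro a b
    by_cases h : f a = g b
    · have hx : 0 < p (a, b) → 0 < pA a ∧ 0 < pB b ∧ 0 < pC (f a) := fun h0 =>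
        ⟨h0.trans_le (hleA a b), h0.trans_le (hleB a b), (h0.trans_le (hleA a b)).trans_le (hleC a)⟩
      have := mul_log_ratio_le (p0 (a, b))
        (div_nonneg (mul_nonneg (pA0 a) (pB0 b)) (pC0 (f a)))
        (fun h0 => by obtain ⟨h1, h2, h3⟩ := hx h0; positivity)
      simp only [hq, h, if_true]
      rw [← h]
      refine le_trans (le_of_eq ?_) this
      rcases (p0 (a, b)).eq_or_lt with h0 | h0
      · simp [← h0]
      · obtain ⟨h1, h2, h3⟩ := hx h0
        rw [Real.log_div (by positivity) h3.ne', Real.log_mul h1.ne' h2.ne']; ring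
    · simp [hq, h, hsupp a b h]
  have hqsum : ∑ a, ∑ b, q a b ≤ 1 := by
    have h1 : ∑ a, pA a = 1 := sum_measureReal_preimage hA
    rw [← h1]
    refine Finset.sum_le_sum fun a _ => ?_
    have : ∑ b, q a b = pA a / pC (f a) * pC (f a) := by
      refine Eq.trans ?_ (congrArg (pA a / pC (f a) * ·) (hCB (f a)).symm)
      simp only [Finset.mul_sum]
      refine Finset.sum_congr rfl fun b _ => ?_
      simp only [hq, eq_comm (a := f a)]
      split_ifs <;> ring
    rw [this]
    rcases (pC0 (f a)).eq_or_lt with h0 | h0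
    · rw [← h0, mul_zero]; exact pA0 a
    · exact le_of_eq (by field_simp)
  have hpsum : ∑ a, ∑ b, p (a, b) = 1 := by
    rw [← Fintype.sum_prod_type]; exact sum_measureReal_preimage hAB
  change ∑ x, Real.negMulLog (p x) + ∑ c, Real.negMulLog (pC c) ≤
    ∑ a, Real.negMulLog (pA a) + ∑ b, Real.negMulLog (pB b)
  rw [eA, eB, eC, eAB, ← sub_nonpos]
  simp only [← Finset.sum_add_distrib, ← Finset.sum_sub_distrib]
  refine (Finset.sum_le_sum fun a _ => Finset.sum_le_sum fun b _ => hterm a b).trans ?_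
  simp only [Finset.sum_sub_distrib]
  linarith

lemma entropy_prodMk_le (hb : 1 ≤ b) {A : Ω → α} {B : Ω → β} (hA : MeasurableFibers A)
    (hB : MeasurableFibers B) :
    entropy b μ (fun ω => (A ω, B ω)) ≤ entropy b μ A + entropy b μ B := by
  have := entropy_submodular (μ := μ) hb hA hB (fun _ => ()) (fun _ => ()) (fun _ => rfl)
  rw [entropy_const] at this
  linarith

end EntropyInequalities

/-! ### Functional dependence, exact and almost sure. -/

section Factoring

set_option linter.unusedSectionVars false

variable {Ω α β γ δ : Type*} [MeasurableSpace Ω] [Fintype α] [Fintype β] [Fintype γ] [Fintype δ]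
  {μ : Measure Ω} [IsProbabilityMeasure μ] {b : ℝ}

lemma exists_comp_of_factorsThrough [Nonempty Ω] {A : Ω → α} {B : Ω → β}
    (h : A.FactorsThrough B) : ∃ f : β → α, ∀ ω, A ω = f (B ω) := by
  obtain ⟨ω⟩ := ‹Nonempty Ω›
  exact ⟨Function.extend B A (fun _ => A ω), fun ω => (h.extend_apply _ ω).symm⟩

lemma entropy_mono (hb : 1 ≤ b) {A : Ω → α} {B : Ω → β} (hB : MeasurableFibers B)
    (h : A.FactorsThrough B) : entropy b μ A ≤ entropy b μ B := by
  have := μ.nonempty_of_neZero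
  obtain ⟨f, hf⟩ := exists_comp_of_factorsThrough h
  rw [funext hf]
  exact entropy_comp_le hb hB f

/-- The working form of strong subadditivity: `J` is anything the pair reveals and `M` anything both
sides know, with dependence expressed by constancy on fibres, so that no explicit functions are
needed. -/
lemma entropy_submod (hb : 1 ≤ b) {A : Ω → α} {B : Ω → β} {J : Ω → δ} {M : Ω → γ}
    (hA : MeasurableFibers A) (hB : MeasurableFibers B)
    (hJ : J.FactorsThrough (fun ω => (A ω, B ω)))
    (hMA : M.FactorsThrough A) (hMB : M.FactorsThrough B) :
    entropy b μ J + entropy b μ M ≤ entropy b μ A + entropy b μ B := by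
  have := μ.nonempty_of_neZero
  obtain ⟨f, hf⟩ := exists_comp_of_factorsThrough hMA
  obtain ⟨g, hg⟩ := exists_comp_of_factorsThrough hMB
  have h1 := entropy_submodular (μ := μ) hb hA hB f g (fun ω => (hf ω).symm.trans (hg ω))
  rw [← funext hf] at h1
  have h2 := entropy_mono (μ := μ) hb (hA.prodMk hB) hJ
  linarith

/-- The sub-tuple of a family of random variables indexed by `s`. -/
def subtuple {ι : Type*} {κ : ι → Type*} (A : ∀ i, Ω → κ i) (s : Finset ι) (ω : Ω) (i : s) :
    κ i := A i ω

variable {ι : Type*} [DecidableEq ι] {κ : ι → Type*} [∀ i, Fintype (κ i)] {A : ∀ i, Ω → κ i}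

lemma MeasurableFibers.subtuple (hA : ∀ i, MeasurableFibers (A i)) (s : Finset ι) :
    MeasurableFibers (subtuple A s) :=
  MeasurableFibers.pi (A := fun i : s => A i) fun i => hA i

lemma subtuple_eq_iff {s : Finset ι} {ω ω' : Ω} :
    subtuple A s ω = subtuple A s ω' ↔ ∀ i ∈ s, A i ω = A i ω' := by
  simp [subtuple, funext_iff]

lemma entropy_subtuple_le (hb : 1 ≤ b) (hA : ∀ i, MeasurableFibers (A i))
    (s : Finset ι) : entropy b μ (subtuple A s) ≤ ∑ i ∈ s, entropy b μ (A i) := by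
  induction s using Finset.induction_on with
  | empty =>
    rw [Finset.sum_empty, ← entropy_const (b := b) (μ := μ) ()]
    exact entropy_mono hb (fun _ => .const _) fun ω ω' _ => by simp [subtuple_eq_iff]
  | insert i s hi ih =>
    rw [Finset.sum_insert hi]
    have h1 := entropy_prodMk_le (μ := μ) hb (hA i) (MeasurableFibers.subtuple hA s)
    have h2 : entropy b μ (subtuple A (insert i s)) ≤
        entropy b μ (fun ω => (A i ω, subtuple A s ω)) := by
      refine entropy_mono hb ((hA i).prodMk (MeasurableFibers.subtuple hA s)) fun ω ω' h => ?_
      simpa [subtuple_eq_iff] using h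
    linarith

/-- `A` is almost surely a function of `B`, in entropic form: `H(A, B) ≤ H(B)`. -/
def Determined (b : ℝ) (μ : Measure Ω) (A : Ω → α) (B : Ω → β) : Prop :=
  entropy b μ (fun ω => (A ω, B ω)) ≤ entropy b μ B

lemma determined_of_factorsThrough (hb : 1 ≤ b) {A : Ω → α} {B : Ω → β}
    (hB : MeasurableFibers B) (h : A.FactorsThrough B) : Determined b μ A B :=
  entropy_mono hb hB fun _ _ e => Prod.ext (h e) e

lemma determined_of_condEntropy_eq_zero {A : Ω → α} {B : Ω → β}
    (h : condEntropy b μ A B = 0) : Determined b μ A B :=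
  (sub_eq_zero.1 h).le

lemma Determined.trans (hb : 1 ≤ b) {A : Ω → α} {B : Ω → β} {C : Ω → γ}
    (hA : MeasurableFibers A) (hB : MeasurableFibers B) (hC : MeasurableFibers C)
    (hAB : Determined b μ A B) (hBC : Determined b μ B C) : Determined b μ A C := by
  have h1 := entropy_submod (μ := μ) hb (hA.prodMk hB) (hB.prodMk hC)
    (J := fun ω => (A ω, C ω)) (M := B) (fun ω ω' h => by simp_all) (fun ω ω' h => by simp_all)
    (fun ω ω' h => by simp_all)
  unfold Determined at *
  linarith

lemma Determined.prodMk (hb : 1 ≤ b) {A : Ω → α} {B : Ω → β} {C : Ω → γ}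
    (hA : MeasurableFibers A) (hB : MeasurableFibers B) (hC : MeasurableFibers C)
    (hAC : Determined b μ A C) (hBC : Determined b μ B C) :
    Determined b μ (fun ω => (A ω, B ω)) C := by
  have h1 := entropy_submod (μ := μ) hb (hA.prodMk hC) (hB.prodMk hC)
    (J := fun ω => ((A ω, B ω), C ω)) (M := C) (fun ω ω' h => by simp_all)
    (fun ω ω' h => by simp_all) (fun ω ω' h => by simp_all)
  unfold Determined at *
  linarith

lemma Determined.subtuple (hb : 1 ≤ b) (hA : ∀ i, MeasurableFibers (A i)) {C : Ω → γ}
    (hC : MeasurableFibers C) (s : Finset ι) (h : ∀ i ∈ s, Determined b μ (A i) C) :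
    Determined b μ (subtuple A s) C := by
  induction s using Finset.induction_on with
  | empty =>
    exact determined_of_factorsThrough hb hC fun ω ω' _ => by simp [subtuple_eq_iff]
  | insert i s hi ih =>
    have h1 := Determined.prodMk hb (hA i) (MeasurableFibers.subtuple hA s) hC
      (h i (Finset.mem_insert_self i s)) (ih fun j hj => h j (Finset.mem_insert_of_mem hj))
    refine Determined.trans hb (MeasurableFibers.subtuple hA _)
      ((hA i).prodMk (MeasurableFibers.subtuple hA s)) hC
      (determined_of_factorsThrough hb ((hA i).prodMk (MeasurableFibers.subtuple hA s))
        fun ω ω' h => ?_) h1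
    simpa [subtuple_eq_iff] using h

end Factoring

/-- The Shearer inequality for a submodular set function: if every element of `E` lies in exactly
`m` of the sets `B u`, then `m (h E - h ∅) ≤ ∑ u, (h (B u) - h ∅)`. -/
lemma shearer {ι τ : Type*} [DecidableEq ι] (h : Finset ι → ℝ)
    (hsub : ∀ s t, h (s ∪ t) + h (s ∩ t) ≤ h s + h t) (J : Finset τ) (B : τ → Finset ι)
    (E : Finset ι) (m : ℕ) (hB : ∀ u ∈ J, B u ⊆ E)
    (hm : ∀ i ∈ E, (J.filter (fun u => i ∈ B u)).card = m) :
    m * (h E - h ∅) ≤ ∑ u ∈ J, (h (B u) - h ∅) := by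
  have key : ∀ s ⊆ E, m * (h s - h ∅) ≤ ∑ u ∈ J, (h (B u ∩ s) - h ∅) := by
    intro s
    induction s using Finset.induction_on with
    | empty => intro _; simp
    | insert i s hi ih =>
      intro hs
      have ih' := ih ((Finset.subset_insert i s).trans hs)
      have hstep : ∑ u ∈ J, (if i ∈ B u then h (insert i s) - h s else 0) ≤
          ∑ u ∈ J, (h (B u ∩ insert i s) - h (B u ∩ s)) := by
        refine Finset.sum_le_sum fun u _ => ?_
        split_ifs with hu
        -- Diminishing returns: adding `i` to the smaller set `B u ∩ s` gains at least as much as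
        -- adding it to `s`.
        · have := hsub (B u ∩ insert i s) s
          rw [show (B u ∩ insert i s) ∪ s = insert i s by ext x; simp; grind,
            show (B u ∩ insert i s) ∩ s = B u ∩ s by ext x; simp; grind] at this
          linarith
        · rw [Finset.inter_insert_of_notMem hu, sub_self]
      rw [← Finset.sum_filter, Finset.sum_const, hm i (hs (Finset.mem_insert_self i s)),
        nsmul_eq_mul] at hstep
      simp only [Finset.sum_sub_distrib] at hstep ih' ⊢
      linarith
  have := key E subset_rfl
  rwa [Finset.sum_congr rfl fun u hu => by rw [Finset.inter_eq_left.2 (hB u hu)]] at this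

/-! ### Converse bounds on the two rates. -/

namespace Scheme

set_option linter.unusedSectionVars false

variable {K S L : ℕ} {F : Type u} [Field F] [Fintype F] (𝒮 : Scheme K S L F)

lemma fibers_W (k : Fin K) : MeasurableFibers (𝒮.W k) :=
  measurableFibers_of_measurable (𝒮.measurable_W k)

lemma fibers_Z (V : UserGroup K S) : MeasurableFibers (𝒮.Z V) :=
  measurableFibers_of_measurable (𝒮.measurable_Z V)

lemma fibers_X (k : Fin K) : MeasurableFibers (𝒮.X k) :=
  measurableFibers_of_measurable (𝒮.measurable_X k)

lemma fibers_Y (U₁ : Finset (Fin K)) (k : Fin K) : MeasurableFibers (𝒮.Y U₁ k) :=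
  measurableFibers_of_measurable (𝒮.measurable_Y U₁ k)

lemma fibers_inputs : MeasurableFibers (fun ω k => 𝒮.W k ω) :=
  MeasurableFibers.pi 𝒮.fibers_W

lemma fibers_sumInputs (U₁ : Finset (Fin K)) : MeasurableFibers (𝒮.sumInputs U₁) :=
  𝒮.fibers_inputs.comp (fun w => ∑ k ∈ U₁, w k)

lemma fibers_userKeys (k : Fin K) : MeasurableFibers (𝒮.userKeys k) :=
  MeasurableFibers.pi (A := fun V : {V : UserGroup K S // k ∈ V.1} => 𝒮.Z V.1)
    fun V => 𝒮.fibers_Z V.1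

lemma one_lt_card : (1 : ℝ) < Fintype.card F := by exact_mod_cast Fintype.one_lt_card

lemma one_le_card : (1 : ℝ) ≤ Fintype.card F := one_lt_card.le

/-- All messages seen by the server when the users of `U₁` survive the first round. -/
def transcript (U₁ : Finset (Fin K)) (ω : 𝒮.Ω) :
    (∀ k, 𝒮.Msg₁ k) × (∀ k : U₁, 𝒮.Msg₂ U₁ k) :=
  ((fun k => 𝒮.X k ω), (fun k : U₁ => 𝒮.Y U₁ k ω))

lemma fibers_transcript (U₁ : Finset (Fin K)) : MeasurableFibers (𝒮.transcript U₁) :=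
  (MeasurableFibers.pi 𝒮.fibers_X).prodMk
    (MeasurableFibers.pi (A := fun k : U₁ => 𝒮.Y U₁ k) fun k => 𝒮.fibers_Y U₁ k)

variable {𝒮} {U : ℕ}

lemma H_input (h : 𝒮.IsSecureAggregation U) (k : Fin K) : 𝒮.H (𝒮.W k) = L := by
  have hq : (1 : ℝ) < Fintype.card F := one_lt_card
  have hlog := Real.log_pos hq
  unfold H entropy
  simp only [h.uniform k, Finset.sum_const, Finset.card_univ, Fintype.card_fun, Fintype.card_fin,
    nsmul_eq_mul, Real.negMulLog, one_div, Real.log_inv, Real.log_pow]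
  have : (Fintype.card F : ℝ) ^ L ≠ 0 := by positivity
  push_cast
  field_simp

lemma H_vector_le {A : 𝒮.Ω → (Fin L → F)} (hA : MeasurableFibers A) : 𝒮.H A ≤ L := by
  have hlog := Real.log_pos (one_lt_card (F := F))
  refine (entropy_le_log_card one_le_card hA).trans (le_of_eq ?_)
  rw [Fintype.card_fun, Fintype.card_fin, Nat.cast_pow, Real.log_pow]
  field_simp

/-- The keys of a set of groups together with the inputs of a set of users. -/
def sources (𝒮 : Scheme K S L F) (P : Finset (UserGroup K S)) (Q : Finset (Fin K)) (ω : 𝒮.Ω) :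
    (∀ V : P, 𝒮.Key V) × (Q → Fin L → F) :=
  (subtuple 𝒮.Z P ω, subtuple 𝒮.W Q ω)

lemma fibers_sources (P : Finset (UserGroup K S)) (Q : Finset (Fin K)) :
    MeasurableFibers (𝒮.sources P Q) :=
  (MeasurableFibers.subtuple 𝒮.fibers_Z P).prodMk (MeasurableFibers.subtuple 𝒮.fibers_W Q)

lemma sources_eq_iff {P : Finset (UserGroup K S)} {Q : Finset (Fin K)} {ω ω' : 𝒮.Ω} :
    𝒮.sources P Q ω = 𝒮.sources P Q ω' ↔
      (∀ V ∈ P, 𝒮.Z V ω = 𝒮.Z V ω') ∧ ∀ k ∈ Q, 𝒮.W k ω = 𝒮.W k ω' := by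
  rw [← subtuple_eq_iff, ← subtuple_eq_iff]; simp [sources]

lemma H_sources_le (h : 𝒮.IsSecureAggregation U) (P : Finset (UserGroup K S))
    (Q : Finset (Fin K)) : 𝒮.H (𝒮.sources P Q) ≤ ∑ V ∈ P, 𝒮.H (𝒮.Z V) + Q.card * L := by
  have h1 := entropy_prodMk_le (μ := 𝒮.μ) (one_le_card (F := F))
    (MeasurableFibers.subtuple 𝒮.fibers_Z P) (MeasurableFibers.subtuple 𝒮.fibers_W Q)
  have h2 := entropy_subtuple_le (μ := 𝒮.μ) (one_le_card (F := F)) 𝒮.fibers_Z P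
  have h3 := entropy_subtuple_le (μ := 𝒮.μ) (one_le_card (F := F)) 𝒮.fibers_W Q
  have h4 : ∑ k ∈ Q, entropy (Fintype.card F) 𝒮.μ (𝒮.W k) = Q.card * L :=
    (Finset.sum_congr rfl fun k _ => H_input h k).trans (by simp)
  rw [h4] at h3
  exact h1.trans (add_le_add h2 h3)

/-- Subadditivity bounds this block and the complementary one from above, and by `IndependentKeys`
the bounds add up to the joint entropy of all sources. Hence both are tight. -/
lemma H_sources (h : 𝒮.IsSecureAggregation U) (P : Finset (UserGroup K S))
    (Q : Finset (Fin K)) : 𝒮.H (𝒮.sources P Q) = ∑ V ∈ P, 𝒮.H (𝒮.Z V) + Q.card * L := by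
  refine le_antisymm (H_sources_le h P Q) ?_
  have h1 := H_sources_le h Pᶜ Qᶜ
  have h2 := entropy_prodMk_le (μ := 𝒮.μ) (one_le_card (F := F)) (𝒮.fibers_sources P Q)
    (𝒮.fibers_sources Pᶜ Qᶜ)
  have h3 : 𝒮.H (fun ω => ((fun V => 𝒮.Z V ω), (fun k => 𝒮.W k ω))) ≤
      𝒮.H (fun ω => (𝒮.sources P Q ω, 𝒮.sources Pᶜ Qᶜ ω)) := by
    refine entropy_mono one_le_card ((𝒮.fibers_sources P Q).prodMk (𝒮.fibers_sources Pᶜ Qᶜ))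
      fun ω ω' e => ?_
    simp only [Prod.mk.injEq, sources_eq_iff] at e
    refine Prod.ext (funext fun V => ?_) (funext fun k => ?_)
    · by_cases hV : V ∈ P
      exacts [e.1.1 V hV, e.2.1 V (by simpa using hV)]
    · by_cases hk : k ∈ Q
      exacts [e.1.2 k hk, e.2.2 k (by simpa using hk)]
  rw [h.keys, Finset.sum_congr rfl fun k _ => H_input h k] at h3
  have h4 : (Q.card : ℝ) + (Qᶜ.card : ℝ) = K := by
    have := Finset.card_add_card_compl Q
    rw [Fintype.card_fin] at this
    exact_mod_cast this
  have h5 := Finset.sum_add_sum_compl P fun V => 𝒮.H (𝒮.Z V)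
  simp only [Finset.sum_const, Finset.card_univ, Fintype.card_fin, nsmul_eq_mul] at h3
  rw [← h4] at h3
  unfold H at *
  linarith

/-- If the inputs are determined by `A`, the sum over `U₁` and `K - 2` of the inputs, then
`H(A, sum) ≥ 2 L`. -/
lemma two_mul_le_H_pair (h : 𝒮.IsSecureAggregation U) {α : Type*} [Fintype α] {A : 𝒮.Ω → α}
    (hA : MeasurableFibers A) (U₁ Q : Finset (Fin K)) (hQ : Q.card + 2 = K)
    (hdet : ∀ ω ω', A ω = A ω' → 𝒮.sumInputs U₁ ω = 𝒮.sumInputs U₁ ω' →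
      (∀ k ∈ Q, 𝒮.W k ω = 𝒮.W k ω') → ∀ k, 𝒮.W k ω = 𝒮.W k ω') :
    2 * (L : ℝ) ≤ 𝒮.H (fun ω => (A ω, 𝒮.sumInputs U₁ ω)) := by
  have h1 := H_sources h ∅ Finset.univ
  have h2 := H_sources h ∅ Q
  have h3 := entropy_prodMk_le (μ := 𝒮.μ) (one_le_card (F := F))
    (hA.prodMk (𝒮.fibers_sumInputs U₁)) (𝒮.fibers_sources ∅ Q)
  have h4 : 𝒮.H (𝒮.sources ∅ Finset.univ) ≤
      𝒮.H (fun ω => ((A ω, 𝒮.sumInputs U₁ ω), 𝒮.sources ∅ Q ω)) := by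
    refine entropy_mono one_le_card
      ((hA.prodMk (𝒮.fibers_sumInputs U₁)).prodMk (𝒮.fibers_sources ∅ Q)) fun ω ω' e => ?_
    simp only [Prod.mk.injEq, sources_eq_iff] at e ⊢
    exact ⟨by simp, fun k _ => hdet ω ω' e.1.1 e.1.2 e.2.2 k⟩
  -- All K inputs have entropy K L, and those in `Q` account for only (K - 2) L of it.
  have h5 : (Q.card : ℝ) + 2 = K := by exact_mod_cast hQ
  simp only [Finset.sum_empty, Finset.card_univ, Fintype.card_fin, zero_add] at h1 h2
  rw [← h5] at h1
  unfold H at *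
  linarith

/-- Security forces a part `B` of the transcript to be independent of a function `A` of the
inputs whenever `A` is independent of the sum over the surviving users. -/
lemma masking (h : 𝒮.IsSecureAggregation U) {α β : Type*} [Fintype α] [Fintype β]
    {A : 𝒮.Ω → α} {B : 𝒮.Ω → β} (hA : MeasurableFibers A) (hB : MeasurableFibers B)
    {U₁ : Finset (Fin K)} (hU₁ : U ≤ U₁.card)
    (hAW : A.FactorsThrough (fun ω k => 𝒮.W k ω)) (hBM : B.FactorsThrough (𝒮.transcript U₁))
    (h2 : 2 * (L : ℝ) ≤ 𝒮.H (fun ω => (A ω, 𝒮.sumInputs U₁ ω))) :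
    L + 𝒮.H B ≤ 𝒮.H (fun ω => (A ω, B ω)) := by
  have hb := one_le_card (F := F)
  have hS := 𝒮.fibers_sumInputs U₁
  have hM := 𝒮.fibers_transcript U₁
  have hW := 𝒮.fibers_inputs
  have hsec : 𝒮.condI (fun ω k => 𝒮.W k ω) (𝒮.transcript U₁) (𝒮.sumInputs U₁) = 0 :=
    h.secure U₁ hU₁
  -- The security equality I(W; transcript | sum) = 0 is weakened in turn: the transcript to `B`,
  -- the inputs to `A`, and then the conditioning on the sum is removed. The last move costs at most
  -- H(sum) ≤ L, which is why 2 L is required of the pair.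
  have h3 := entropy_submod (μ := 𝒮.μ) hb
    (A := fun ω => ((fun k => 𝒮.W k ω), B ω, 𝒮.sumInputs U₁ ω))
    (B := fun ω => (𝒮.transcript U₁ ω, 𝒮.sumInputs U₁ ω))
    (J := fun ω => ((fun k => 𝒮.W k ω), 𝒮.transcript U₁ ω, 𝒮.sumInputs U₁ ω))
    (M := fun ω => (B ω, 𝒮.sumInputs U₁ ω)) (hW.prodMk (hB.prodMk hS)) (hM.prodMk hS)
    (fun ω ω' e => by simp_all) (fun ω ω' e => by simp_all)
    (fun ω ω' e => by
      simp only [Prod.mk.injEq] at e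
      exact Prod.ext (hBM e.1) e.2)
  have h4 := entropy_submod (μ := 𝒮.μ) hb
    (A := fun ω => (A ω, B ω, 𝒮.sumInputs U₁ ω))
    (B := fun ω => ((fun k => 𝒮.W k ω), 𝒮.sumInputs U₁ ω))
    (J := fun ω => ((fun k => 𝒮.W k ω), B ω, 𝒮.sumInputs U₁ ω))
    (M := fun ω => (A ω, 𝒮.sumInputs U₁ ω)) (hA.prodMk (hB.prodMk hS)) (hW.prodMk hS)
    (fun ω ω' e => by simp_all) (fun ω ω' e => by simp_all)
    (fun ω ω' e => by
      simp only [Prod.mk.injEq] at e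
      exact Prod.ext (hAW e.1) e.2)
  have h5 := entropy_submod (μ := 𝒮.μ) hb
    (A := fun ω => (A ω, B ω)) (B := fun ω => (B ω, 𝒮.sumInputs U₁ ω))
    (J := fun ω => (A ω, B ω, 𝒮.sumInputs U₁ ω)) (M := B) (hA.prodMk hB) (hB.prodMk hS)
    (fun ω ω' e => by simp_all) (fun ω ω' e => by simp_all) (fun ω ω' e => by simp_all)
  have h6 := 𝒮.H_vector_le hS
  unfold condI condMutualInfo condEntropy at hsec
  unfold H at *
  linarith

/-- Converse for the second round. -/
theorem le_sum_H_second (h : 𝒮.IsSecureAggregation U) (hU : 1 ≤ U) {U₁ : Finset (Fin K)}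
    (hU₁ : U₁.card = U) (hUK : U < K) : (L : ℝ) ≤ ∑ k ∈ U₁, 𝒮.H (𝒮.Y U₁ k) := by
  have hb := one_le_card (F := F)
  obtain ⟨j, hj⟩ : ∃ j, j ∉ U₁ := by
    by_contra! hall
    have : U₁ = Finset.univ := Finset.eq_univ_iff_forall.2 hall
    rw [this, Finset.card_univ, Fintype.card_fin] at hU₁
    omega
  obtain ⟨i, hi⟩ : U₁.Nonempty := Finset.card_pos.1 (by omega)
  have hij : i ≠ j := fun e => hj (e ▸ hi)
  -- Decoding concerns `U₁`, but security is invoked for `insert j U₁`: the two sums differ by the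
  -- fresh uniform input of `j`.
  have h2 := two_mul_le_H_pair h (𝒮.fibers_sumInputs U₁) (insert j U₁) ({i, j}ᶜ)
    (by
      have := Finset.card_add_card_compl ({i, j} : Finset (Fin K))
      rw [Finset.card_pair hij, Fintype.card_fin] at this
      omega)
    (by
      intro ω ω' e1 e2 e3 k
      have ej : 𝒮.W j ω = 𝒮.W j ω' := by
        simp only [sumInputs, Finset.sum_insert hj] at e1 e2
        rw [e1] at e2
        exact add_right_cancel e2
      have ei : 𝒮.W i ω = 𝒮.W i ω' := by
        simp only [sumInputs] at e1
        rw [← Finset.add_sum_erase _ _ hi, ← Finset.add_sum_erase _ _ hi,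
          Finset.sum_congr rfl fun k hk => e3 k ?_] at e1
        · exact add_right_cancel e1
        · simp only [Finset.mem_erase] at hk
          simp only [Finset.mem_compl, Finset.mem_insert, Finset.mem_singleton, not_or]
          exact ⟨hk.1, fun e => hj (e ▸ hk.2)⟩
      by_cases h1 : k = i
      · rw [h1, ei]
      · by_cases h2 : k = j
        · rw [h2, ej]
        · exact e3 k (by simp [h1, h2]))
  have hX : MeasurableFibers (fun ω k => 𝒮.X k ω) := MeasurableFibers.pi 𝒮.fibers_X
  have hm := masking h (𝒮.fibers_sumInputs U₁) hX (U₁ := insert j U₁)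
    (by rw [Finset.card_insert_of_notMem hj]; omega)
    (fun ω ω' e => by
      simp only [funext_iff] at e
      exact Finset.sum_congr rfl fun k _ => funext fun x => e k x)
    (fun ω ω' e => by
      simp only [transcript, Prod.mk.injEq] at e
      exact e.1) h2
  have hYt := MeasurableFibers.subtuple (𝒮.fibers_Y U₁) U₁
  have hXt := MeasurableFibers.subtuple 𝒮.fibers_X U₁
  have hdec : Determined (Fintype.card F) 𝒮.μ (𝒮.sumInputs U₁)
      (fun ω => (subtuple 𝒮.X U₁ ω, subtuple (𝒮.Y U₁) U₁ ω)) :=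
    determined_of_condEntropy_eq_zero (h.decode U₁ U₁ subset_rfl hU₁.ge)
  have hdec' : Determined (Fintype.card F) 𝒮.μ (𝒮.sumInputs U₁)
      (fun ω => ((fun k => 𝒮.X k ω), subtuple (𝒮.Y U₁) U₁ ω)) :=
    hdec.trans hb (𝒮.fibers_sumInputs U₁) (hXt.prodMk hYt) (hX.prodMk hYt)
      (determined_of_factorsThrough hb (hX.prodMk hYt) fun ω ω' e => by
        simp only [Prod.mk.injEq, funext_iff] at e
        exact Prod.ext (subtuple_eq_iff.2 fun k _ => e.1 k) (funext e.2))
  have h4 := entropy_mono (μ := 𝒮.μ) hb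
    (A := fun ω => (𝒮.sumInputs U₁ ω, fun k => 𝒮.X k ω))
    ((𝒮.fibers_sumInputs U₁).prodMk (hX.prodMk hYt)) (fun ω ω' e => by simp_all)
  have h5 := entropy_prodMk_le (μ := 𝒮.μ) hb hX hYt
  have h6 := entropy_subtuple_le (μ := 𝒮.μ) hb (𝒮.fibers_Y U₁) U₁
  unfold Determined at hdec'
  unfold H at *
  linarith

/-- The groups containing user `k`. -/
def groupsOf (K S : ℕ) (k : Fin K) : Finset (UserGroup K S) :=
  Finset.univ.filter fun V => k ∈ V.1

/-- The groups containing user `k` and some member of `U₂`. -/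
def groupsMeeting (S : ℕ) (k : Fin K) (U₂ : Finset (Fin K)) : Finset (UserGroup K S) :=
  Finset.univ.filter fun V => k ∈ V.1 ∧ ¬ Disjoint V.1 U₂

/-- The groups containing some member of `U₂` but not user `k`. -/
def groupsAvoiding (S : ℕ) (k : Fin K) (U₂ : Finset (Fin K)) : Finset (UserGroup K S) :=
  Finset.univ.filter fun V => k ∉ V.1 ∧ ¬ Disjoint V.1 U₂

/-- The first-round message of user `k` together with the keys it shares with `U₂` reveals the
input of user `k`. -/
lemma H_input_message_keys_le (h : 𝒮.IsSecureAggregation U) (k : Fin K) {U₂ : Finset (Fin K)}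
    (hk : k ∉ U₂) (hU₂ : U ≤ U₂.card) :
    𝒮.H (fun ω => ((𝒮.W k ω, 𝒮.X k ω), subtuple 𝒮.Z (groupsMeeting S k U₂) ω)) ≤
      𝒮.H (fun ω => (𝒮.X k ω, subtuple 𝒮.Z (groupsMeeting S k U₂) ω)) := by
  have hb := one_le_card (F := F)
  set B := groupsMeeting S k U₂ with hB
  set P := groupsAvoiding S k U₂ with hP
  set Zk := groupsOf K S k with hZk
  have mB : ∀ V, V ∈ B ↔ k ∈ V.1 ∧ ¬ Disjoint V.1 U₂ := fun V => by simp [hB, groupsMeeting]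
  have mP : ∀ V, V ∈ P ↔ k ∉ V.1 ∧ ¬ Disjoint V.1 U₂ := fun V => by simp [hP, groupsAvoiding]
  have mZ : ∀ V, V ∈ Zk ↔ k ∈ V.1 := fun V => by simp [hZk, groupsOf]
  have fB := MeasurableFibers.subtuple 𝒮.fibers_Z B
  have fZ := MeasurableFibers.subtuple 𝒮.fibers_Z Zk
  have fQ := 𝒮.fibers_sources P U₂
  have fX := 𝒮.fibers_X k
  have fW := 𝒮.fibers_W k
  -- `C` holds X_k together with the inputs and all keys of the users in `U₂`, hence every message
  -- the server receives when only `k` drops out after the first round.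
  set C := fun ω => ((𝒮.X k ω, subtuple 𝒮.Z B ω), 𝒮.sources P U₂ ω) with hC
  have fC : MeasurableFibers C := (fX.prodMk fB).prodMk fQ
  have hkeys : ∀ ω ω', C ω = C ω' → ∀ j ∈ U₂, ∀ V : UserGroup K S, j ∈ V.1 →
      𝒮.Z V ω = 𝒮.Z V ω' := by
    intro ω ω' e j hj V hV
    simp only [hC, Prod.mk.injEq, sources_eq_iff, subtuple_eq_iff] at e
    have hd : ¬ Disjoint V.1 U₂ := Finset.not_disjoint_iff.2 ⟨j, hV, hj⟩
    by_cases hkV : k ∈ V.1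
    · exact e.1.2 V ((mB V).2 ⟨hkV, hd⟩)
    · exact e.2.1 V ((mP V).2 ⟨hkV, hd⟩)
  have hown : ∀ j ∈ U₂, Determined (Fintype.card F) 𝒮.μ
      (fun ω => (𝒮.W j ω, 𝒮.userKeys j ω)) C := by
    intro j hj
    refine determined_of_factorsThrough hb fC fun ω ω' e => Prod.ext ?_ ?_
    · have e' := e
      simp only [hC, Prod.mk.injEq, sources_eq_iff] at e'
      exact e'.2.2 j hj
    · exact funext fun V => hkeys ω ω' e j hj V.1 V.2
  have dX : ∀ j ∈ insert k U₂, Determined (Fintype.card F) 𝒮.μ (𝒮.X j) C := by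
    intro j hj
    rcases Finset.mem_insert.1 hj with rfl | hj
    · exact determined_of_factorsThrough hb fC fun ω ω' e => by
        simp only [hC, Prod.mk.injEq] at e; exact e.1.1
    · exact Determined.trans hb (𝒮.fibers_X j)
        ((𝒮.fibers_W j).prodMk (𝒮.fibers_userKeys j)) fC
        (determined_of_condEntropy_eq_zero (h.encode₁ j)) (hown j hj)
  have hcard : U ≤ (insert k U₂).card := hU₂.trans (Finset.card_le_card (Finset.subset_insert _ _))
  have dY : ∀ j ∈ U₂, Determined (Fintype.card F) 𝒮.μ (𝒮.Y (insert k U₂) j) C := by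
    intro j hj
    exact Determined.trans hb (𝒮.fibers_Y _ j)
      ((𝒮.fibers_W j).prodMk (𝒮.fibers_userKeys j)) fC
      (determined_of_condEntropy_eq_zero
        (h.encode₂ _ hcard j (Finset.mem_insert_of_mem hj))) (hown j hj)
  have fXt := MeasurableFibers.subtuple 𝒮.fibers_X (insert k U₂)
  have fYt := MeasurableFibers.subtuple (𝒮.fibers_Y (insert k U₂)) U₂
  have dS : Determined (Fintype.card F) 𝒮.μ (𝒮.sumInputs (insert k U₂)) C :=
    Determined.trans hb (𝒮.fibers_sumInputs _) (fXt.prodMk fYt) fC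
      (determined_of_condEntropy_eq_zero
        (h.decode (insert k U₂) U₂ (Finset.subset_insert _ _) hU₂))
      (Determined.prodMk hb fXt fYt fC (Determined.subtuple hb 𝒮.fibers_X fC _ dX)
        (Determined.subtuple hb (𝒮.fibers_Y _) fC _ dY))
  have fSQ := (𝒮.fibers_sumInputs (insert k U₂)).prodMk fQ
  have dW : Determined (Fintype.card F) 𝒮.μ (𝒮.W k) C := by
    refine Determined.trans hb fW fSQ fC (determined_of_factorsThrough hb fSQ fun ω ω' e => ?_)
      (Determined.prodMk hb (𝒮.fibers_sumInputs _) fQ fC dS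
        (determined_of_factorsThrough hb fC fun ω ω' e => by
          simp only [hC, Prod.mk.injEq] at e; exact e.2))
    simp only [Prod.mk.injEq, sources_eq_iff, sumInputs, Finset.sum_insert hk] at e
    rw [Finset.sum_congr rfl fun j hj => e.2.2 j hj] at e
    exact add_right_cancel e.1
  -- the inputs and keys outside the reach of user `k` are independent of the rest
  have hsub := entropy_submod (μ := 𝒮.μ) hb
    (A := fun ω => (𝒮.W k ω, C ω)) (B := fun ω => (𝒮.X k ω, 𝒮.sources Zk {k} ω))
    (J := 𝒮.sources (P ∪ Zk) (insert k U₂))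
    (M := fun ω => ((𝒮.W k ω, 𝒮.X k ω), subtuple 𝒮.Z B ω))
    (fW.prodMk fC) (fX.prodMk (𝒮.fibers_sources _ _))
    (fun ω ω' e => by
      simp only [hC, Prod.mk.injEq, sources_eq_iff] at e ⊢
      refine ⟨fun V hV => ?_, fun j hj => ?_⟩
      · rcases Finset.mem_union.1 hV with hV | hV
        exacts [e.1.2.2.1 V hV, e.2.2.1 V hV]
      · rcases Finset.mem_insert.1 hj with rfl | hj
        exacts [e.1.1, e.1.2.2.2 j hj])
    (fun ω ω' e => by
      simp only [hC, Prod.mk.injEq] at e ⊢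
      exact ⟨⟨e.1, e.2.1.1⟩, e.2.1.2⟩)
    (fun ω ω' e => by
      simp only [Prod.mk.injEq, sources_eq_iff, subtuple_eq_iff] at e ⊢
      exact ⟨⟨e.2.2 k (by simp), e.1⟩, fun V hV => e.2.1 V ((mZ V).2 ((mB V).1 hV).1)⟩)
  have hbound : 𝒮.H (fun ω => (𝒮.X k ω, 𝒮.sources Zk {k} ω)) ≤ 𝒮.H (𝒮.sources Zk {k}) := by
    refine Determined.trans hb fX (fW.prodMk (𝒮.fibers_userKeys k)) (𝒮.fibers_sources _ _)
      (determined_of_condEntropy_eq_zero (h.encode₁ k))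
      (determined_of_factorsThrough hb (𝒮.fibers_sources _ _) fun ω ω' e => ?_)
    rw [sources_eq_iff] at e
    exact Prod.ext (e.2 k (by simp)) (funext fun V => e.1 V.1 ((mZ V.1).2 V.2))
  have hmod : 𝒮.H (𝒮.sources (P ∪ Zk) (insert k U₂)) =
      𝒮.H (𝒮.sources P U₂) + 𝒮.H (𝒮.sources Zk {k}) := by
    rw [H_sources h, H_sources h, H_sources h, Finset.sum_union, Finset.card_insert_of_notMem hk]
    · simp; ring
    · refine Finset.disjoint_left.2 fun V h1 h2 => ?_
      exact ((mP V).1 h1).1 ((mZ V).1 h2)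
  -- The entropy of `sources P U₂` now occurs on both sides and cancels: W_k is determined without
  -- that independent side information.
  have hCle := entropy_prodMk_le (μ := 𝒮.μ) hb (fX.prodMk fB) fQ
  unfold Determined at dW
  unfold H at *
  linarith

/-- The `U`-sets to be discarded are those missing `V`. They are exactly the `U`-subsets of the
complement of `V`, which has K - S elements and already excludes `k`. -/
lemma card_filter_not_disjoint (k : Fin K) (V : UserGroup K S) (hk : k ∈ V.1) :
    (((Finset.univ.erase k).powersetCard U).filter
      (fun U₂ => V ∈ groupsMeeting S k U₂)).card =
      (K - 1).choose U - (K - S).choose U := by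
  have h1 : ((Finset.univ.erase k).powersetCard U).card = (K - 1).choose U := by
    rw [Finset.card_powersetCard, Finset.card_erase_of_mem (Finset.mem_univ k), Finset.card_univ,
      Fintype.card_fin]
  have h2 : (V.1ᶜ.powersetCard U).card = (K - S).choose U := by
    rw [Finset.card_powersetCard, Finset.card_compl, Fintype.card_fin, V.2]
  have h3 : V.1ᶜ.powersetCard U ⊆ (Finset.univ.erase k).powersetCard U :=
    Finset.powersetCard_mono fun x hx => by
      simp only [Finset.mem_compl] at hx
      simp only [Finset.mem_erase, Finset.mem_univ, and_true]
      rintro rfl; exact hx hk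
  rw [← h1, ← h2, ← Finset.card_sdiff_of_subset h3]
  congr 1
  ext U₂
  simp only [groupsMeeting, Finset.mem_filter, Finset.mem_univ, true_and, hk, Finset.mem_sdiff,
    Finset.mem_powersetCard]
  rw [← le_compl_iff_disjoint_left]
  tauto

/-- Shearer is applied to g(A) = H(W_k, X_k, Z_A). Masking gives g(∅) = L + H(X_k), independence
gives g(all groups of k) ≥ L + Σ H(Z_V), and recoverability of W_k gives g(groups meeting U₂) - g(∅)
≤ Σ H(Z_V) - L. Each key is counted m times on both sides, so the key entropies cancel and leave L
once for every U₂ against m H(X_k). -/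
lemma H_message_bound (h : 𝒮.IsSecureAggregation U) (hU : 1 ≤ U) (hUK : U < K) (k : Fin K) :
    ((K - 1).choose U : ℝ) * L ≤
      (((K - 1).choose U - (K - S).choose U : ℕ) : ℝ) * 𝒮.H (𝒮.X k) := by
  have hb := one_le_card (F := F)
  have fX := 𝒮.fibers_X k
  have fW := 𝒮.fibers_W k
  have fT := fW.prodMk fX
  set J := (Finset.univ.erase k).powersetCard U with hJ
  set m := (K - 1).choose U - (K - S).choose U with hm
  set z := fun V => 𝒮.H (𝒮.Z V) with hz
  set g : Finset (UserGroup K S) → ℝ :=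
    fun A => 𝒮.H (fun ω => ((𝒮.W k ω, 𝒮.X k ω), subtuple 𝒮.Z A ω)) with hg
  have fg : ∀ A, MeasurableFibers (fun ω => ((𝒮.W k ω, 𝒮.X k ω), subtuple 𝒮.Z A ω)) :=
    fun A => fT.prodMk (MeasurableFibers.subtuple 𝒮.fibers_Z A)
  have hsh := shearer g
    (fun A A' => entropy_submod hb (fg A) (fg A')
      (fun ω ω' e => by
        simp only [Prod.mk.injEq, subtuple_eq_iff] at e ⊢
        refine ⟨e.1.1, fun V hV => ?_⟩
        rcases Finset.mem_union.1 hV with hV | hV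
        exacts [e.1.2 V hV, e.2.2 V hV])
      (fun ω ω' e => by
        simp only [Prod.mk.injEq, subtuple_eq_iff] at e ⊢
        exact ⟨e.1, fun V hV => e.2 V (Finset.mem_inter.1 hV).1⟩)
      (fun ω ω' e => by
        simp only [Prod.mk.injEq, subtuple_eq_iff] at e ⊢
        exact ⟨e.1, fun V hV => e.2 V (Finset.mem_inter.1 hV).2⟩))
    J (fun U₂ => groupsMeeting S k U₂) (groupsOf K S k) m
    (fun U₂ _ V hV => by
      simp only [groupsMeeting, groupsOf, Finset.mem_filter, Finset.mem_univ, true_and] at hV ⊢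
      exact hV.1)
    (fun V hV => card_filter_not_disjoint k V (by
      simpa only [groupsOf, Finset.mem_filter, Finset.mem_univ, true_and] using hV))
  obtain ⟨j, hj⟩ : ∃ j : Fin K, j ≠ k := by
    have : Nontrivial (Fin K) := Fin.nontrivial_iff_two_le.2 (by omega)
    exact exists_ne k
  have hmask : L + 𝒮.H (𝒮.X k) ≤ 𝒮.H (fun ω => (𝒮.W k ω, 𝒮.X k ω)) := by
    refine masking h fW fX (U₁ := Finset.univ) (by simpa using hUK.le)
      (fun ω ω' e => congrFun e k)
      (fun ω ω' e => congrFun (congrArg Prod.fst e) k)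
      (two_mul_le_H_pair h fW Finset.univ ({j, k}ᶜ) ?_ ?_)
    · have := Finset.card_add_card_compl ({j, k} : Finset (Fin K))
      rw [Finset.card_pair hj, Fintype.card_fin] at this
      omega
    · intro ω ω' e1 e2 e3
      have hne : ∀ i, i ≠ j → 𝒮.W i ω = 𝒮.W i ω' := by
        intro i hi
        by_cases hik : i = k
        · rw [hik, e1]
        · exact e3 i (by simp [hi, hik])
      intro i
      by_cases hij : i = j
      · subst hij
        simp only [sumInputs] at e2
        rw [← Finset.add_sum_erase _ _ (Finset.mem_univ i),
          ← Finset.add_sum_erase _ _ (Finset.mem_univ i),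
          Finset.sum_congr rfl fun l hl => hne l (Finset.ne_of_mem_erase hl)] at e2
        exact add_right_cancel e2
      · exact hne i hij
  have hT : 𝒮.H (fun ω => (𝒮.W k ω, 𝒮.X k ω)) ≤ L + 𝒮.H (𝒮.X k) := by
    have := entropy_prodMk_le (μ := 𝒮.μ) hb fW fX
    have h1 := H_input h k
    unfold H at *
    linarith
  have hg0 : g ∅ = 𝒮.H (fun ω => (𝒮.W k ω, 𝒮.X k ω)) := by
    refine le_antisymm (entropy_mono hb fT fun ω ω' e => ?_)
      (entropy_mono hb (fg ∅) fun ω ω' e => by simp_all)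
    exact Prod.ext e (subtuple_eq_iff.2 fun V hV => by simp at hV)
  have hgE : L + ∑ V ∈ groupsOf K S k, z V ≤ g (groupsOf K S k) := by
    have h1 := H_sources h (groupsOf K S k) {k}
    have h2 : 𝒮.H (𝒮.sources (groupsOf K S k) {k}) ≤ g (groupsOf K S k) := by
      refine entropy_mono hb (fg _) fun ω ω' e => ?_
      simp only [Prod.mk.injEq, sources_eq_iff, subtuple_eq_iff, Finset.mem_singleton,
        forall_eq] at e ⊢
      exact ⟨e.2, e.1.1⟩
    rw [h1] at h2
    simp only [Finset.card_singleton, Nat.cast_one, one_mul] at h2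
    linarith
  have hgB : ∀ U₂ ∈ J, g (groupsMeeting S k U₂) - g ∅ ≤
      (∑ V ∈ groupsMeeting S k U₂, z V) - L := by
    intro U₂ hU₂
    rw [hJ, Finset.mem_powersetCard] at hU₂
    have h1 := H_input_message_keys_le h k (U₂ := U₂)
      (fun hk => by simpa using hU₂.1 hk) hU₂.2.ge
    have h2 := entropy_prodMk_le (μ := 𝒮.μ) hb fX
      (MeasurableFibers.subtuple 𝒮.fibers_Z (groupsMeeting S k U₂))
    have h3 := entropy_subtuple_le (μ := 𝒮.μ) hb 𝒮.fibers_Z (groupsMeeting S k U₂)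
    rw [hg0]
    simp only [hg, hz]
    unfold H at *
    linarith
  have hdouble : ∑ U₂ ∈ J, ∑ V ∈ groupsMeeting S k U₂, z V =
      m * ∑ V ∈ groupsOf K S k, z V := by
    rw [Finset.sum_comm' (t' := groupsOf K S k)
      (s' := fun V => J.filter (fun U₂ => V ∈ groupsMeeting S k U₂)), Finset.mul_sum]
    · refine Finset.sum_congr rfl fun V hV => ?_
      rw [Finset.sum_const, card_filter_not_disjoint k V, nsmul_eq_mul]
      simpa only [groupsOf, Finset.mem_filter, Finset.mem_univ, true_and] using hV
    · intro U₂ V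
      simp only [groupsOf, groupsMeeting, Finset.mem_filter, Finset.mem_univ, true_and]
      tauto
  have hJcard : (J.card : ℝ) = (K - 1).choose U := by
    rw [hJ, Finset.card_powersetCard, Finset.card_erase_of_mem (Finset.mem_univ k),
      Finset.card_univ, Fintype.card_fin]
  have hsum := hsh.trans (Finset.sum_le_sum hgB)
  rw [Finset.sum_sub_distrib, hdouble, Finset.sum_const, nsmul_eq_mul, hJcard, hg0] at hsum
  have hm0 : (0 : ℝ) ≤ m := Nat.cast_nonneg m
  nlinarith [mul_le_mul_of_nonneg_left hgE hm0, mul_le_mul_of_nonneg_left hT hm0]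

/-- Converse for the first round. -/
theorem le_mul_H_first (h : 𝒮.IsSecureAggregation U) (hU : 1 ≤ U) (hUK : U < K) (hS : 1 ≤ S)
    (hSK : S ≤ K) (k : Fin K) :
    ((K - 1).choose (S - 1) : ℝ) * L ≤
      (((K - 1).choose (S - 1) : ℝ) - ((K - 1 - U).choose (S - 1) : ℝ)) * 𝒮.H (𝒮.X k) := by
  have h1 := H_message_bound h hU hUK k
  have hle : (K - S).choose U ≤ (K - 1).choose U := Nat.choose_le_choose U (by omega)
  rw [Nat.cast_sub hle] at h1
  -- Both sides count ordered pairs of disjoint subsets, of sizes U and S - 1, of a set with K - 1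
  -- elements.
  have hid : (K - 1).choose U * (K - 1 - U).choose (S - 1) =
      (K - 1).choose (S - 1) * (K - S).choose U := by
    have e1 := Nat.choose_mul (n := K - 1) (Nat.le_add_right U (S - 1))
    have e2 := Nat.choose_mul (n := K - 1) (Nat.le_add_left (S - 1) U)
    rw [Nat.add_sub_cancel_left] at e1
    rw [Nat.add_sub_cancel, show K - 1 - (S - 1) = K - S by omega] at e2
    rw [← e1, ← e2, Nat.choose_symm_add]
  have hid' : ((K - 1).choose U : ℝ) * (K - 1 - U).choose (S - 1) =
      (K - 1).choose (S - 1) * (K - S).choose U := by exact_mod_cast hid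
  have hpos : (0 : ℝ) < (K - 1).choose U := by
    exact_mod_cast Nat.choose_pos (by omega)
  have hn : (0 : ℝ) ≤ (K - 1).choose (S - 1) := Nat.cast_nonneg _
  refine le_of_mul_le_mul_left ?_ hpos
  have := mul_le_mul_of_nonneg_left h1 hn
  linear_combination this + 𝒮.H (𝒮.X k) * hid'

end Scheme

/-! ### Tuples and coefficients in multilinear algebra. -/

/-- An enumeration of a finite set of cardinality `s` by `Fin s`. -/
noncomputable def enum {α : Type*} {s : ℕ} (T : Finset α) (h : T.card = s) (i : Fin s) : α :=
  (T.equivFinOfCardEq h).symm i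

section Enumeration

variable {α : Type*} {s : ℕ} {T : Finset α} {h : T.card = s}

lemma enum_mem (i : Fin s) : enum T h i ∈ T := ((T.equivFinOfCardEq h).symm i).2

lemma enum_injective : Function.Injective (enum T h) :=
  Subtype.val_injective.comp (T.equivFinOfCardEq h).symm.injective

lemma exists_enum_eq {a : α} (ha : a ∈ T) : ∃ i, enum T h i = a :=
  ⟨T.equivFinOfCardEq h ⟨a, ha⟩, by simp [enum]⟩

variable {E A : Type*} [Field E] [AddCommGroup A] [Module E A]

/-- An injective tuple with values in `T` is a permutation of the chosen enumeration, and permuting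
the arguments only changes the sign. -/
lemma alternating_eq_zero_of_enum (g : A [⋀^Fin s]→ₗ[E] E) (f : α → A) (h : T.card = s)
    (h0 : g (fun i => f (enum T h i)) = 0) {y : Fin s → α} (hy : Function.Injective y)
    (hT : ∀ i, y i ∈ T) : g (fun i => f (y i)) = 0 := by
  have hinj : Function.Injective (fun i => (⟨y i, hT i⟩ : T)) := fun i j e =>
    hy (congrArg Subtype.val e)
  have hbij : Function.Bijective (fun i => (⟨y i, hT i⟩ : T)) :=
    (Fintype.bijective_iff_injective_and_card _).2 ⟨hinj, by simp [h]⟩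
  let σ : Equiv.Perm (Fin s) := (Equiv.ofBijective _ hbij).trans (T.equivFinOfCardEq h)
  have hσ : (fun i => f (y i)) = (fun i => f (enum T h i)) ∘ σ := by
    funext i
    simp [σ, enum]
  rw [hσ, AlternatingMap.map_perm, h0, smul_zero]

/-- By duality, a functional vanishing on the common kernel of the `l i` lies in their span. Later
linear reconstructions are thereby obtained from mere vanishing statements. -/
lemma exists_coeff_of_ker_le {ι : Type*} [Fintype ι] (l : ι → A →ₗ[E] E) (φ : A →ₗ[E] E)
    (h : ∀ v, (∀ i, l i v = 0) → φ v = 0) : ∃ c : ι → E, ∀ v, φ v = ∑ i, c i * l i v := by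
  have hmem : φ ∈ Submodule.span E (Set.range l) := by
    refine mem_span_of_iInf_ker_le_ker fun v hv => ?_
    rw [Submodule.mem_iInf] at hv
    exact h v hv
  obtain ⟨c, hc⟩ := (Submodule.mem_span_range_iff_exists_fun E).1 hmem
  refine ⟨c, fun v => ?_⟩
  rw [← hc]; simp

end Enumeration

/-! ### Sets meeting the first summand, and their even distribution. -/

/-- The `s`-element subsets of `Fin U ⊕ Fin r` that meet `Fin U`. -/
abbrev HitSet (U r s : ℕ) : Type :=
  {M : Finset (Fin U ⊕ Fin r) // M.card = s ∧ ∃ u, Sum.inl u ∈ M}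

section HitSet

variable {U r s : ℕ}

lemma card_hitSet : Fintype.card (HitSet U r s) = (U + r).choose s - r.choose s := by
  classical
  have h1 : ((Finset.univ : Finset (Fin U ⊕ Fin r)).powersetCard s).card = (U + r).choose s := by
    simp
  have h2 : ((Finset.univ.map (Function.Embedding.inr : Fin r ↪ Fin U ⊕ Fin r)).powersetCard
      s).card = r.choose s := by
    simp
  rw [← h1, ← h2, ← Finset.card_sdiff_of_subset
    (Finset.powersetCard_mono (Finset.subset_univ _)), Fintype.card_subtype]
  congr 1
  ext M
  simp only [Finset.mem_filter, Finset.mem_univ, true_and, Finset.mem_sdiff,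
    Finset.mem_powersetCard, Finset.subset_univ, Finset.subset_iff (s₁ := M)
    (s₂ := Finset.univ.map _), Finset.mem_map, Function.Embedding.inr_apply]
  refine and_congr_right fun hM => ?_
  constructor
  · rintro ⟨u, hu⟩ ⟨h, -⟩
    obtain ⟨x, hx⟩ := h hu
    simp at hx
  · intro hn
    by_contra! hc
    refine hn ⟨fun x hx => ?_, hM⟩
    rcases x with u | v
    · exact absurd hx (hc u)
    · exact ⟨v, rfl⟩

/-- The rotation by `τ` of the first summand. -/
def rot (U r : ℕ) [NeZero U] (τ : Fin U) : Fin U ⊕ Fin r ≃ Fin U ⊕ Fin r :=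
  Equiv.sumCongr (Equiv.addRight τ) (Equiv.refl _)

/-- Rotating a set that meets the first summand. -/
def HitSet.rotate [NeZero U] (τ : Fin U) (M : HitSet U r s) : HitSet U r s :=
  ⟨M.1.map (rot U r τ).toEmbedding, by simp [M.2.1], by
    obtain ⟨u, hu⟩ := M.2.2
    exact ⟨u + τ, by simpa [rot] using hu⟩⟩

lemma HitSet.inl_mem_rotate [NeZero U] (τ u : Fin U) (M : HitSet U r s) :
    Sum.inl (u + τ) ∈ (M.rotate τ).1 ↔ Sum.inl u ∈ M.1 := by
  simp [HitSet.rotate, rot]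

lemma HitSet.rotate_injective [NeZero U] (τ : Fin U) :
    Function.Injective (HitSet.rotate τ : HitSet U r s → HitSet U r s) := fun M M' h => by
  have := congrArg Subtype.val h
  exact Subtype.ext (Finset.map_injective _ this)

/-- The offsets from `β` to the members of `M` in the first summand. -/
def HitSet.offsets [NeZero U] (M : HitSet U r s) (β : Fin U) : Finset (Fin U) :=
  Finset.univ.filter fun t => Sum.inl (β + t) ∈ M.1

lemma HitSet.offsets_nonempty [NeZero U] (M : HitSet U r s) (β : Fin U) :
    (M.offsets β).Nonempty := by
  obtain ⟨u, hu⟩ := M.2.2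
  exact ⟨u - β, by simpa [HitSet.offsets] using hu⟩

lemma HitSet.offsets_rotate [NeZero U] (M : HitSet U r s) (β τ : Fin U) :
    (M.rotate τ).offsets (β + τ) = M.offsets β := by
  ext t
  simp only [HitSet.offsets, Finset.mem_filter, Finset.mem_univ, true_and]
  rw [← HitSet.inl_mem_rotate τ (β + t), show β + τ + t = β + t + τ by abel]

/-- The first member of `M` in the first summand, in cyclic order starting from `β`. -/
def HitSet.first [NeZero U] (M : HitSet U r s) (β : Fin U) : Fin U :=
  β + (M.offsets β).min' (M.offsets_nonempty β)

lemma HitSet.first_mem [NeZero U] (M : HitSet U r s) (β : Fin U) : Sum.inl (M.first β) ∈ M.1 := by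
  have := Finset.min'_mem (M.offsets β) (M.offsets_nonempty β)
  simpa [HitSet.offsets, HitSet.first] using this

lemma HitSet.first_rotate [NeZero U] (M : HitSet U r s) (β τ : Fin U) :
    (M.rotate τ).first (β + τ) = M.first β + τ := by
  simp only [HitSet.first, HitSet.offsets_rotate]
  abel

/-- Rotating `M` and `β` together shifts `first` by the same amount, so all `U` fibres are equally
large. They partition `U` times as many pairs as there are hit sets. -/
lemma card_first_fiber [NeZero U] (u : Fin U) :
    (Finset.univ.filter fun p : HitSet U r s × Fin U => p.1.first p.2 = u).card =
      Fintype.card (HitSet U r s) := by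
  have hle : ∀ u u' : Fin U,
      (Finset.univ.filter fun p : HitSet U r s × Fin U => p.1.first p.2 = u).card ≤
      (Finset.univ.filter fun p : HitSet U r s × Fin U => p.1.first p.2 = u').card := by
    intro u u'
    refine Finset.card_le_card_of_injOn (fun p => (p.1.rotate (u' - u), p.2 + (u' - u))) ?_ ?_
    · intro p hp
      simp only [Finset.coe_filter, Finset.mem_univ, true_and, Set.mem_ofPred_eq] at hp ⊢
      rw [HitSet.first_rotate, hp]; abel
    · intro p _ p' _ h
      simp only [Prod.mk.injEq, add_left_inj] at h
      exact Prod.ext (HitSet.rotate_injective _ h.1) h.2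
  have hsum := Finset.card_eq_sum_card_fiberwise
    (s := (Finset.univ : Finset (HitSet U r s × Fin U))) (t := Finset.univ)
    (f := fun p => p.1.first p.2) (fun _ _ => Finset.mem_coe.2 (Finset.mem_univ _))
  rw [Finset.sum_congr rfl fun u' _ => le_antisymm (hle u' u) (hle u u'), Finset.sum_const,
    Finset.card_univ, Finset.card_univ, Fintype.card_prod, Fintype.card_fin, smul_eq_mul,
    mul_comm] at hsum
  exact (Nat.eq_of_mul_eq_mul_left (NeZero.pos U) hsum).symm

/-- The pairs `(M, β)` can be distributed evenly among the points of `Fin U`, each pair going to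
a member of `M`. -/
lemma exists_even_assignment [NeZero U] :
    ∃ Φ : HitSet U r s × Fin U ≃ HitSet U r s × Fin U,
      ∀ p, Sum.inl p.2 ∈ (Φ p).1.1 := by
  have e : ∀ u : Fin U, Nonempty (HitSet U r s ≃
      {p : HitSet U r s × Fin U // p.1.first p.2 = u}) := fun u =>
    Fintype.card_eq.1 (by
      rw [Fintype.card_subtype (fun p : HitSet U r s × Fin U => p.1.first p.2 = u),
        card_first_fiber])
  replace e := fun u => (e u).some
  let Φ : HitSet U r s × Fin U ≃ HitSet U r s × Fin U :=
    (Equiv.prodComm _ _).trans ((Equiv.sigmaEquivProd _ _).symm.trans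
      ((Equiv.sigmaCongrRight e).trans
        (Equiv.sigmaFiberEquiv fun p : HitSet U r s × Fin U => p.1.first p.2)))
  refine ⟨Φ, fun p => ?_⟩
  have h : (Φ p).1.first (Φ p).2 = p.2 := (e p.2 p.1).2
  rw [← h]
  exact HitSet.first_mem _ _

end HitSet

/-! ### Alternating forms vanishing on the second summand. -/

section Forms

variable {E : Type*} [Field E] {U r s : ℕ}

/-- The alternating form `(v₁, …, v_s) ↦ det (v_i)_m`, with `m` running over `M`. -/
noncomputable def minorForm (E : Type*) [Field E] (M : HitSet U r s) :
    (Fin U ⊕ Fin r → E) [⋀^Fin s]→ₗ[E] E :=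
  Matrix.detRowAlternating.compLinearMap (LinearMap.funLeft E E (enum M.1 M.2.1))

lemma minorForm_apply (M : HitSet U r s) (v : Fin s → Fin U ⊕ Fin r → E) :
    minorForm E M v = (Matrix.of fun i i' => v i (enum M.1 M.2.1 i')).det := rfl

/-- The alternating form with coordinates `w`. -/
noncomputable def form (w : HitSet U r s → E) : (Fin U ⊕ Fin r → E) [⋀^Fin s]→ₗ[E] E :=
  ∑ M, w M • minorForm E M

lemma form_apply (w : HitSet U r s → E) (v : Fin s → Fin U ⊕ Fin r → E) :
    form w v = ∑ M, w M * minorForm E M v := by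
  let φ : ((Fin U ⊕ Fin r → E) [⋀^Fin s]→ₗ[E] E) →+ E :=
    { toFun := fun g => g v, map_zero' := rfl, map_add' := fun _ _ => rfl }
  exact map_sum φ _ _

/-- Evaluation of forms at a fixed tuple, as a linear map in the coordinates. -/
noncomputable def formEval (v : Fin s → Fin U ⊕ Fin r → E) : (HitSet U r s → E) →ₗ[E] E where
  toFun w := form w v
  map_add' w w' := by simp [form_apply, add_mul, Finset.sum_add_distrib]
  map_smul' c w := by simp [form_apply, Finset.mul_sum, mul_assoc]

lemma formEval_apply (v : Fin s → Fin U ⊕ Fin r → E) (w : HitSet U r s → E) :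
    formEval v w = form w v := rfl

/-- Every index set `M` contains a point of the first summand, and the corresponding column of each
minor vanishes on these unit vectors. -/
lemma form_single_inr (w : HitSet U r s → E) (y : Fin s → Fin r) :
    form w (fun i => Pi.single (Sum.inr (y i)) 1) = 0 := by
  rw [form_apply]
  refine Finset.sum_eq_zero fun M _ => ?_
  obtain ⟨u, hu⟩ := M.2.2
  obtain ⟨i, hi⟩ := exists_enum_eq (h := M.2.1) hu
  rw [minorForm_apply, Matrix.det_eq_zero_of_column_eq_zero i, mul_zero]
  intro j
  simp [hi]

lemma form_single_enum (w : HitSet U r s → E) (M : HitSet U r s) :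
    form w (fun i => Pi.single (enum M.1 M.2.1 i) 1) = w M := by
  rw [form_apply, Finset.sum_eq_single M]
  · have : (Matrix.of fun i i' => (Pi.single (enum M.1 M.2.1 i) (1 : E) : Fin U ⊕ Fin r → E)
        (enum M.1 M.2.1 i')) = (1 : Matrix (Fin s) (Fin s) E) := by
      ext i i'
      simp [Matrix.one_apply, Pi.single_apply, enum_injective.eq_iff, eq_comm]
    rw [minorForm_apply, this]; simp
  · intro M' _ hM'
    obtain ⟨x, hx, hx'⟩ : ∃ x ∈ M'.1, x ∉ M.1 := by
      by_contra! hsub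
      exact hM' (Subtype.ext (Finset.eq_of_subset_of_card_le hsub (by rw [M.2.1, M'.2.1])))
    obtain ⟨i, hi⟩ := exists_enum_eq (h := M'.2.1) hx
    rw [minorForm_apply, Matrix.det_eq_zero_of_column_eq_zero i, mul_zero]
    intro j
    rw [Matrix.of_apply, hi, Pi.single_apply, if_neg]
    rintro rfl
    exact hx' (enum_mem j)
  · simp

lemma form_injective {w : HitSet U r s → E} (h : form w = 0) : w = 0 := by
  funext M
  rw [← form_single_enum w M, h]; rfl

variable {K t : ℕ} (a : Fin K → Fin U ⊕ Fin r → E)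

/-- The form is determined on tuples starting with `a j` by its values on the sub-tuples of
`a` through `j` avoiding `k`. -/
lemma form_cons_eq_zero (hK : K = U + r + 1) {j k : Fin K} (hjk : j ≠ k)
    (ha : LinearIndependent E (fun i : {i // i ≠ k} => a i)) (w : HitSet U r (t + 1) → E)
    (h : ∀ (T : Finset (Fin K)) (hT : T.card = t + 1), j ∈ T → k ∉ T →
      form w (fun i => a (enum T hT i)) = 0) (z : Fin t → Fin U ⊕ Fin r → E) :
    form w (Matrix.vecCons (a j) z) = 0 := by
  have : Nonempty {i // i ≠ k} := ⟨⟨j, hjk⟩⟩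
  let B := basisOfLinearIndependentOfCardEqFinrank ha (by simp [hK])
  -- The contraction by `a j` is tested on the basis of the `a i` with i ≠ k. A tuple containing `j`
  -- gives zero by repetition. Any other one, with `j` prepended, enumerates a set through `j`
  -- avoiding `k`.
  have hcurry : (form w).curryLeft (a j) = 0 := by
    refine Basis.ext_alternating B fun y hy => ?_
    rw [AlternatingMap.curryLeft_apply_apply, AlternatingMap.zero_apply]
    have hB : (fun i => B (y i)) = fun i => a (y i) := by
      simp [B]
    rw [hB]
    have hcons : Matrix.vecCons (a j) (fun i => a (y i)) =
        fun i => a ((Matrix.vecCons j (fun i => (y i).1) : Fin (t + 1) → Fin K) i) := by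
      funext i
      refine Fin.cases ?_ (fun i => ?_) i <;> simp
    by_cases hj : ∃ i, (y i).1 = j
    · obtain ⟨i, hi⟩ := hj
      refine AlternatingMap.map_eq_zero_of_eq _ _ (i := 0) (j := i.succ) ?_ (Fin.succ_ne_zero i).symm
      simp [hi]
    · push Not at hj
      have hinj : Function.Injective (Matrix.vecCons j (fun i => (y i).1) :
          Fin (t + 1) → Fin K) := by
        refine Fin.cons_injective_iff.2 ⟨?_, Subtype.val_injective.comp hy⟩
        rintro ⟨i, hi⟩
        exact hj i hi
      rw [hcons]
      refine alternating_eq_zero_of_enum (form w) a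
        (T := Finset.univ.image (Matrix.vecCons j (fun i => (y i).1)))
        (by rw [Finset.card_image_of_injective _ hinj]; simp) (h _ _ ?_ ?_) hinj
        (fun i => Finset.mem_image_of_mem _ (Finset.mem_univ i))
      · exact Finset.mem_image.2 ⟨0, Finset.mem_univ _, rfl⟩
      · rw [Finset.mem_image]
        rintro ⟨i, -, hi⟩
        refine Fin.cases (fun h0 => ?_) (fun i hi => ?_) i hi
        · exact hjk (by simpa using h0)
        · exact (y i).2 (by simpa using hi)
  have := congrArg (fun g => g z) hcurry
  simpa using this

variable {a}

/-- The vectors `a (ε u)` completed by the standard basis vectors of the second summand. -/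
def frame (a : Fin K → Fin U ⊕ Fin r → E) (ε : Fin U → Fin K) :
    Fin U ⊕ Fin r → Fin U ⊕ Fin r → E :=
  Sum.elim (fun u => a (ε u)) (fun m => Pi.single (Sum.inr m) 1)

/-- The frame is a basis, and the frame tuples not covered by `h` consist only of unit vectors of
the second summand, where the form vanishes automatically. -/
lemma eq_zero_of_form_frame [NeZero U] {ε : Fin U → Fin K} (ha : LinearIndependent E (frame a ε))
    (w : HitSet U r s → E)
    (h : ∀ M : HitSet U r s, form w (fun i => frame a ε (enum M.1 M.2.1 i)) = 0) : w = 0 := by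
  have : Nonempty (Fin U ⊕ Fin r) := ⟨Sum.inl 0⟩
  let B := basisOfLinearIndependentOfCardEqFinrank ha (by simp)
  refine form_injective (Basis.ext_alternating B fun y hy => ?_)
  have hB : (fun i => B (y i)) = fun i => frame a ε (y i) := by simp [B]
  rw [hB, AlternatingMap.zero_apply]
  by_cases hhit : ∃ i u, y i = Sum.inl u
  · obtain ⟨i, u, hi⟩ := hhit
    have hc : (Finset.univ.image y).card = s := by
      rw [Finset.card_image_of_injective _ hy]; simp
    refine alternating_eq_zero_of_enum (form w) (frame a ε) hc
      (h ⟨Finset.univ.image y, hc, u, ?_⟩) hy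
      (fun i => Finset.mem_image_of_mem _ (Finset.mem_univ i))
    exact Finset.mem_image.2 ⟨i, Finset.mem_univ _, hi⟩
  · push Not at hhit
    have : ∀ i, ∃ m, y i = Sum.inr m := fun i => by
      rcases hy' : y i with u | m
      · exact absurd hy' (hhit i u)
      · exact ⟨m, rfl⟩
    choose m hm using this
    have : (fun i => frame a ε (y i)) = fun i => Pi.single (Sum.inr (m i)) 1 := by
      funext i; rw [hm]; rfl
    rw [this]
    exact form_single_inr w m

/-- The value on a frame sub-tuple through `inl u` is a combination of the values on tuples
starting with `a (ε u)` and continuing with standard basis vectors. -/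
lemma exists_coeff_frame (ε : Fin U → Fin K) (u : Fin U) (M : HitSet U r (t + 1))
    (hu : Sum.inl u ∈ M.1) :
    ∃ c : (Fin t → Fin U ⊕ Fin r) → E, ∀ w : HitSet U r (t + 1) → E,
      form w (fun i => frame a ε (enum M.1 M.2.1 i)) =
        ∑ y, c y * form w (Matrix.vecCons (a (ε u)) (fun i => Pi.single (y i) 1)) := by
  refine exists_coeff_of_ker_le
    (fun y : Fin t → Fin U ⊕ Fin r => formEval (Matrix.vecCons (a (ε u)) (fun i => Pi.single (y i) 1)))
    (formEval (fun i => frame a ε (enum M.1 M.2.1 i))) fun w hw => ?_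
  change form w (fun i => frame a ε (enum M.1 M.2.1 i)) = 0
  have hcurry : (form w).curryLeft (a (ε u)) = 0 := by
    refine Basis.ext_alternating (Pi.basisFun E (Fin U ⊕ Fin r)) fun y _ => ?_
    rw [AlternatingMap.curryLeft_apply_apply, AlternatingMap.zero_apply]
    simpa [formEval_apply] using hw y
  obtain ⟨i, hi⟩ := exists_enum_eq (h := M.2.1) hu
  -- A transposition brings the vector `a (ε u)` to the front, so that the vanishing contraction
  -- applies.
  have hperm := (form w).map_perm (fun i => frame a ε (enum M.1 M.2.1 i)) (Equiv.swap 0 i)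
  have hcons : (fun i => frame a ε (enum M.1 M.2.1 i)) ∘ Equiv.swap 0 i =
      Matrix.vecCons (a (ε u))
        (Fin.tail ((fun i => frame a ε (enum M.1 M.2.1 i)) ∘ Equiv.swap 0 i)) := by
    refine (Fin.cons_self_tail _).symm.trans ?_
    rw [Matrix.vecCons]
    congr 1
    simp [hi, frame]
  rw [hcons, ← AlternatingMap.curryLeft_apply_apply, hcurry] at hperm
  have h0 := hperm.symm
  rw [AlternatingMap.zero_apply] at h0
  exact (smul_eq_zero_iff_eq _).1 h0

lemma card_erase_of_mem_group {V : UserGroup K (t + 2)} {k : Fin K} (hk : k ∈ V.1) :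
    (V.1.erase k).card = t + 1 := by
  rw [Finset.card_erase_of_mem hk, V.2]; rfl

/-- The value on a tuple starting with `a j` is a combination of the values on the tuples
`a (V \ {k})`, for the groups `V` through `j` and `k`. -/
lemma exists_coeff_groups (hK : K = U + r + 1) {j k : Fin K} (hjk : j ≠ k)
    (ha : LinearIndependent E (fun i : {i // i ≠ k} => a i)) (z : Fin t → Fin U ⊕ Fin r → E) :
    ∃ c : {V : UserGroup K (t + 2) // j ∈ V.1 ∧ k ∈ V.1} → E,
      ∀ w : HitSet U r (t + 1) → E, form w (Matrix.vecCons (a j) z) =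
        ∑ V, c V * form w (fun i => a (enum _ (card_erase_of_mem_group V.2.2) i)) := by
  refine exists_coeff_of_ker_le
    (fun V : {V : UserGroup K (t + 2) // j ∈ V.1 ∧ k ∈ V.1} =>
      formEval (fun i => a (enum _ (card_erase_of_mem_group V.2.2) i)))
    (formEval (Matrix.vecCons (a j) z)) fun w hw => ?_
  refine form_cons_eq_zero a hK hjk ha w (fun T hT h1 h2 => ?_) z
  have hV : (insert k T).card = t + 2 := by rw [Finset.card_insert_of_notMem h2, hT]
  have key : ∀ (T' : Finset (Fin K)) (hT' : T'.card = t + 1), T' = T →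
      form w (fun i => a (enum T' hT' i)) = 0 → form w (fun i => a (enum T hT i)) = 0 := by
    rintro T' hT' rfl h; exact h
  exact key _ _ (Finset.erase_insert h2)
    (hw ⟨⟨insert k T, hV⟩, Finset.mem_insert_of_mem h1, Finset.mem_insert_self k T⟩)

end Forms

/-! ### General position of the power vectors. -/

section Vandermonde

variable {E : Type*} [Field E] {U r K : ℕ}

/-- The vectors `(1, x_j, x_j², …)` of length `U + r`. -/
def powerVec (x : Fin K → E) (j : Fin K) (m : Fin U ⊕ Fin r) : E :=
  x j ^ (finSumFinEquiv m : ℕ)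

lemma eq_zero_of_sum_mul_pow {I : Type*} [Fintype I] {n : ℕ} (hI : Fintype.card I = n)
    {x : I → E} (hx : Function.Injective x) (c : I → E)
    (h : ∀ m : Fin n, ∑ i, c i * x i ^ (m : ℕ) = 0) (i : I) : c i = 0 := by
  let e := Fintype.equivFinOfCardEq hI
  have := Matrix.eq_zero_of_forall_pow_sum_mul_pow_eq_zero (f := x ∘ e.symm) (v := c ∘ e.symm)
    (hx.comp e.symm.injective) (fun m => by
      rw [← h m]
      exact Equiv.sum_comp e.symm fun i => c i * x i ^ (m : ℕ))
  simpa using congrFun this (e i)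

lemma linearIndependent_powerVec {x : Fin K → E} (hx : Function.Injective x) (hK : K = U + r + 1)
    (k : Fin K) : LinearIndependent E
      (fun i : {i // i ≠ k} => (powerVec x i : Fin U ⊕ Fin r → E)) := by
  rw [Fintype.linearIndependent_iff]
  intro c hc
  refine eq_zero_of_sum_mul_pow (n := U + r) (by simp [hK])
    (x := fun i : {i // i ≠ k} => x i) (hx.comp Subtype.val_injective) c fun m => ?_
  have := congrFun hc (finSumFinEquiv.symm m)
  simpa [powerVec, Finset.sum_apply] using this

/-- The first `U` coordinates carry the powers 0, ..., U - 1. There the unit vectors of the second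
summand vanish and the remaining block is a square Vandermonde matrix. -/
lemma linearIndependent_frame {x : Fin K → E} (hx : Function.Injective x) {ε : Fin U → Fin K}
    (hε : Function.Injective ε) :
    LinearIndependent E (frame (powerVec x : Fin K → Fin U ⊕ Fin r → E) ε) := by
  rw [Fintype.linearIndependent_iff]
  intro c hc
  rw [Fintype.sum_sum_type] at hc
  have hl : ∀ u, c (Sum.inl u) = 0 := by
    refine eq_zero_of_sum_mul_pow (n := U) (by simp) (hx.comp hε) (fun u => c (Sum.inl u))
      fun m => ?_
    have := congrFun hc (Sum.inl m)
    simpa [frame, powerVec, Finset.sum_apply] using this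
  rintro (u | m)
  · exact hl u
  · have := congrFun hc (Sum.inr m)
    simpa [frame, hl, Finset.sum_apply, Pi.single_apply] using this

end Vandermonde

/-! ### Generic combiners over an extension field. -/

section GenericCombiner

variable {E : Type*} [Field E] {U r K t : ℕ}

/-- The index set of the coefficients of the second-round combiners. -/
abbrev CoeffIndex (K U r t : ℕ) : Type :=
  Fin K × HitSet U r (t + 1) × (Fin t → Fin U ⊕ Fin r) × Fin U

/-- The coefficient of the coordinate `M` in the value of a form on a tuple starting with `a j`
and continuing with standard basis vectors. -/
noncomputable def headMinor (a : Fin K → Fin U ⊕ Fin r → E) (j : Fin K) (M : HitSet U r (t + 1))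
    (y : Fin t → Fin U ⊕ Fin r) : E :=
  minorForm E M (Matrix.vecCons (a j) (fun i => Pi.single (y i) 1))

/-- The combiner of user `j`: a combination of the values of the `U` forms on tuples starting
with `a j`. -/
noncomputable def combiner (a : Fin K → Fin U ⊕ Fin r → E) (ξ : CoeffIndex K U r t → E)
    (j : Fin K) (w : HitSet U r (t + 1) → Fin U → E) (i : HitSet U r (t + 1)) : E :=
  ∑ y, ∑ β, ξ (j, i, y, β) *
    form (fun M => w M β) (Matrix.vecCons (a j) (fun l => Pi.single (y l) 1))

/-- The joint matrix of the combiners of the users `ε 0, …, ε (U - 1)`. -/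
noncomputable def combinerMatrix (a : Fin K → Fin U ⊕ Fin r → E) (ξ : CoeffIndex K U r t → E)
    (ε : Fin U → Fin K) :
    Matrix (HitSet U r (t + 1) × Fin U) (HitSet U r (t + 1) × Fin U) E :=
  Matrix.of fun p q => ∑ y, ξ (ε p.2, p.1, y, q.2) * headMinor a (ε p.2) q.1 y

lemma combinerMatrix_mulVec (a : Fin K → Fin U ⊕ Fin r → E) (ξ : CoeffIndex K U r t → E)
    (ε : Fin U → Fin K) (w : HitSet U r (t + 1) → Fin U → E)
    (p : HitSet U r (t + 1) × Fin U) :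
    (combinerMatrix a ξ ε).mulVec (fun q => w q.1 q.2) p = combiner a ξ (ε p.2) w p.1 := by
  simp only [combinerMatrix, combiner, Matrix.mulVec, dotProduct, Matrix.of_apply, form_apply,
    Finset.sum_mul, Finset.mul_sum, headMinor]
  rw [Finset.sum_comm]
  refine Finset.sum_congr rfl fun y _ => ?_
  rw [Fintype.sum_prod_type_right]
  exact Finset.sum_congr rfl fun β _ => Finset.sum_congr rfl fun M _ => by ring

/-- All pairs (frame sub-tuple `M`, form `β`) have to be reported, and user `ε u` can report only
those with `inl u ∈ M`. The even assignment `Φ` gives each user as many pairs as it has outputs. A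
kernel vector then has all its frame values zero, hence is zero. -/
lemma exists_det_combinerMatrix_ne_zero [NeZero U] (a : Fin K → Fin U ⊕ Fin r → E)
    {ε : Fin U → Fin K} (hε : Function.Injective ε) (ha : LinearIndependent E (frame a ε)) :
    ∃ ξ : CoeffIndex K U r t → E, (combinerMatrix a ξ ε).det ≠ 0 := by
  obtain ⟨Φ, hΦ⟩ := exists_even_assignment (U := U) (r := r) (s := t + 1)
  choose c hc using fun p : HitSet U r (t + 1) × Fin U =>
    exists_coeff_frame (a := a) ε p.2 (Φ p).1 (hΦ p)
  -- Output i of user `ε u` reports the value assigned to (i, u) by `Φ`. Users outside the range of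
  -- `ε` get coefficient 0.
  let ξ : CoeffIndex K U r t → E := fun x =>
    Function.extend ε (fun u => if (Φ (x.2.1, u)).2 = x.2.2.2 then c (x.2.1, u) x.2.2.1 else 0)
      0 x.1
  have hξ : ∀ u i y β, ξ (ε u, i, y, β) = if (Φ (i, u)).2 = β then c (i, u) y else 0 :=
    fun u i y β => hε.extend_apply _ _ _
  refine ⟨ξ, fun hdet => ?_⟩
  obtain ⟨v, hv, hv0⟩ := Matrix.exists_mulVec_eq_zero_iff.2 hdet
  refine hv ?_
  have hcomb : ∀ p : HitSet U r (t + 1) × Fin U,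
      form (fun M => v (M, (Φ p).2)) (fun i => frame a ε (enum _ (Φ p).1.2.1 i)) = 0 := by
    intro p
    have h1 := combinerMatrix_mulVec a ξ ε (fun M β => v (M, β)) p
    rw [show (fun q : HitSet U r (t + 1) × Fin U => v (q.1, q.2)) = v from rfl, hv0] at h1
    rw [hc, ← Pi.zero_apply (M := fun _ => E) p, h1, combiner]
    refine Finset.sum_congr rfl fun y _ => ?_
    simp [hξ]
  have hw : ∀ β, (fun M => v (M, β)) = 0 := by
    intro β
    refine eq_zero_of_form_frame ha _ fun M => ?_
    have := hcomb (Φ.symm (M, β))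
    simpa using this
  funext p
  exact congrFun (hw p.2) p.1

/-- Each determinant is a nonzero polynomial in the coefficients `ξ`. So is the product over all
selections of users, and a nonzero polynomial over an infinite field has a nonvanishing point. -/
lemma exists_generic_coeff [NeZero U] [Infinite E] (a : Fin K → Fin U ⊕ Fin r → E)
    (ha : ∀ ε : Fin U → Fin K, Function.Injective ε → LinearIndependent E (frame a ε)) :
    ∃ ξ : CoeffIndex K U r t → E, ∀ ε : Fin U → Fin K, Function.Injective ε →
      (combinerMatrix a ξ ε).det ≠ 0 := by
  classical
  let P : (Fin U ↪ Fin K) → MvPolynomial (CoeffIndex K U r t) E := fun ε =>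
    (Matrix.of fun p q : HitSet U r (t + 1) × Fin U =>
      ∑ y, MvPolynomial.X (ε p.2, p.1, y, q.2) * MvPolynomial.C (headMinor a (ε p.2) q.1 y)).det
  have hP : ∀ ε ξ, MvPolynomial.eval ξ (P ε) = (combinerMatrix a ξ ε).det := by
    intro ε ξ
    rw [RingHom.map_det]
    congr 1
    ext p q
    simp [combinerMatrix]
  have hne : ∏ ε, P ε ≠ 0 := by
    refine Finset.prod_ne_zero_iff.2 fun ε _ h0 => ?_
    obtain ⟨ξ, hξ⟩ := exists_det_combinerMatrix_ne_zero (t := t) a ε.injective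
      (ha ε ε.injective)
    rw [← hP ε ξ, h0, map_zero] at hξ
    exact hξ rfl
  obtain ⟨ξ, hξ⟩ : ∃ ξ, MvPolynomial.eval ξ (∏ ε, P ε) ≠ 0 := by
    by_contra! hall
    exact hne (MvPolynomial.funext fun ξ => by rw [hall ξ, map_zero])
  refine ⟨ξ, fun ε hε => ?_⟩
  rw [map_prod, Finset.prod_ne_zero_iff] at hξ
  have := hξ ⟨ε, hε⟩ (Finset.mem_univ _)
  rwa [hP] at this

/-- The points and coefficients are found in the algebraic closure; this allows the determinants to
be read in a finite subextension. -/
lemma map_combinerMatrix {E' : Type*} [Field E'] (φ : E →+* E') (x : Fin K → E)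
    (ξ : CoeffIndex K U r t → E) (ε : Fin U → Fin K) :
    φ.mapMatrix (combinerMatrix (powerVec x) ξ ε) =
      combinerMatrix (powerVec (fun j => φ (x j))) (fun i => φ (ξ i)) ε := by
  have hm : ∀ j M y, φ (headMinor (powerVec x : Fin K → Fin U ⊕ Fin r → E) j M y) =
      headMinor (t := t) (powerVec (fun j => φ (x j))) j M y := by
    intro j M y
    simp only [headMinor, minorForm_apply]
    rw [RingHom.map_det]
    congr 1
    ext i i'
    refine Fin.cases ?_ (fun i => ?_) i
    · simp [powerVec]
    · simp [Pi.single_apply, apply_ite φ]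
  ext p q
  simp [combinerMatrix, hm]

/-- Over a finite field there are extensions of arbitrarily large degree with good evaluation
points and combiner coefficients. -/
theorem exists_extension (F : Type u) [Field F] [Fintype F] (K U r t m₀ : ℕ) [NeZero U] :
    ∃ (E : Type u) (_ : Field E) (_ : Algebra F E), FiniteDimensional F E ∧
      m₀ ≤ finrank F E ∧ ∃ x : Fin K → E, Function.Injective x ∧
      ∃ ξ : CoeffIndex K U r t → E, ∀ ε : Fin U → Fin K, Function.Injective ε →
        (combinerMatrix (powerVec x : Fin K → Fin U ⊕ Fin r → E) ξ ε).det ≠ 0 := by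
  classical
  let A := AlgebraicClosure F
  have : Infinite A := IsAlgClosed.instInfinite
  let x : Fin K ↪ A := (Function.Embedding.trans ⟨_, Fin.val_injective⟩ (Infinite.natEmbedding A))
  obtain ⟨ξ, hξ⟩ := exists_generic_coeff (t := t)
    (powerVec x : Fin K → Fin U ⊕ Fin r → A)
    fun ε hε => linearIndependent_frame x.injective hε
  -- Adjoining q ^ m₀ further elements forces the degree of the extension to be at least m₀.
  obtain ⟨B, hB⟩ := Infinite.exists_subset_card_eq A (Fintype.card F ^ m₀)
  let G : Set A := Set.range x ∪ Set.range ξ ∪ B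
  have hfin : Finite G := ((Set.finite_range x).union (Set.finite_range ξ)).union B.finite_toSet
  let E := IntermediateField.adjoin F G
  have hsub : G ⊆ E := IntermediateField.subset_adjoin F G
  have hfd : FiniteDimensional F E := IntermediateField.finiteDimensional_adjoin fun y _ =>
    (AlgebraicClosure.isAlgebraic F).isAlgebraic y |>.isIntegral
  let x' : Fin K → E := fun j => ⟨x j, hsub (Or.inl (Or.inl ⟨j, rfl⟩))⟩
  let ξ' : CoeffIndex K U r t → E := fun i => ⟨ξ i, hsub (Or.inl (Or.inr ⟨i, rfl⟩))⟩
  refine ⟨E, inferInstance, inferInstance, hfd, ?_, x', fun i j h => x.injective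
    (congrArg Subtype.val h), ξ', fun ε hε h0 => hξ ε hε ?_⟩
  · have : Finite E := Module.finite_of_finite F
    have : Fintype E := Fintype.ofFinite E
    have hcard : Fintype.card F ^ m₀ ≤ Fintype.card E := by
      rw [← hB, ← Fintype.card_coe]
      exact Fintype.card_le_of_injective (fun b : B => (⟨b, hsub (Or.inr b.2)⟩ : E))
        fun b b' h => Subtype.ext (congrArg (fun e : E => (e : A)) h)
    rw [Module.card_eq_pow_finrank (K := F) (V := E)] at hcard
    exact (Nat.pow_le_pow_iff_right Fintype.one_lt_card).1 hcard
  · have := map_combinerMatrix (algebraMap E A) x' ξ' ε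
    have h2 : (combinerMatrix (powerVec x : Fin K → Fin U ⊕ Fin r → A) ξ ε).det =
        algebraMap E A (combinerMatrix (powerVec x') ξ' ε).det := by
      rw [RingHom.map_det, this]; rfl
    rw [h2, h0, map_zero]

end GenericCombiner

/-! ### The linear code, over the extension and then over the base field. -/

section ExtensionData

variable {E : Type*} [Field E] {U r K t : ℕ}

/-- The combiner as a linear map. -/
noncomputable def combinerLin (a : Fin K → Fin U ⊕ Fin r → E) (ξ : CoeffIndex K U r t → E)
    (j : Fin K) : (HitSet U r (t + 1) → Fin U → E) →ₗ[E] (HitSet U r (t + 1) → E) where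
  toFun := combiner a ξ j
  map_add' w w' := by
    funext i
    simp [combiner, form_apply, add_mul, mul_add, Finset.sum_add_distrib]
  map_smul' c w := by
    funext i
    simp only [combiner, form_apply, Pi.smul_apply, smul_eq_mul, Finset.mul_sum, RingHom.id_apply]
    exact Finset.sum_congr rfl fun y _ => Finset.sum_congr rfl fun β _ =>
      Finset.sum_congr rfl fun M _ => by ring

/-- The share of the input attached to the group `V` by user `k`: the values of the `U` forms on
the tuple `a (V \ {k})`. -/
noncomputable def shareLin (a : Fin K → Fin U ⊕ Fin r → E) (V : UserGroup K (t + 2))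
    (k : Fin K) (hk : k ∈ V.1) : (HitSet U r (t + 1) → Fin U → E) →ₗ[E] (Fin U → E) where
  toFun w β := form (fun M => w M β) (fun i => a (enum _ (card_erase_of_mem_group hk) i))
  map_add' w w' := by
    funext β
    simp [form_apply, add_mul, Finset.sum_add_distrib]
  map_smul' c w := by
    funext β
    simp [form_apply, Finset.mul_sum, mul_assoc]

/-- This is what makes the keys groupwise: user `j` knows every mask that hides the shares needed
for its combiner at the input of `k`. -/
lemma exists_combiner_eq_sum_share (a : Fin K → Fin U ⊕ Fin r → E) (ξ : CoeffIndex K U r t → E)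
    (hK : K = U + r + 1) {j k : Fin K} (hjk : j ≠ k)
    (ha : LinearIndependent E (fun i : {i // i ≠ k} => a i)) :
    ∃ Λ : {V : UserGroup K (t + 2) // j ∈ V.1 ∧ k ∈ V.1} →
        (Fin U → E) →ₗ[E] (HitSet U r (t + 1) → E),
      ∀ w, combinerLin a ξ j w = ∑ V, Λ V (shareLin a V.1 k V.2.2 w) := by
  choose c hc using fun y : Fin t → Fin U ⊕ Fin r =>
    exists_coeff_groups (t := t) hK hjk ha (fun l => Pi.single (y l) 1)
  refine ⟨fun V =>
    { toFun := fun b i => ∑ y, ∑ β, ξ (j, i, y, β) * (c y V * b β)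
      map_add' := fun b b' => by
        funext i
        simp [mul_add, Finset.sum_add_distrib]
      map_smul' := fun e b => by
        funext i
        simp only [Pi.smul_apply, smul_eq_mul, Finset.mul_sum, RingHom.id_apply]
        exact Finset.sum_congr rfl fun y _ => Finset.sum_congr rfl fun β _ => by ring },
    fun w => ?_⟩
  funext i
  simp only [combinerLin, combiner, LinearMap.coe_mk, AddHom.coe_mk, Finset.sum_apply, shareLin]
  refine Eq.trans (Finset.sum_congr rfl fun y _ => ?_) Finset.sum_comm
  refine Eq.trans (Finset.sum_congr rfl fun β _ => ?_) Finset.sum_comm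
  rw [hc, Finset.mul_sum]

lemma eq_zero_of_combinerLin_eq_zero {a : Fin K → Fin U ⊕ Fin r → E}
    {ξ : CoeffIndex K U r t → E} {ε : Fin U → Fin K} (hdet : (combinerMatrix a ξ ε).det ≠ 0)
    {w : HitSet U r (t + 1) → Fin U → E} (h : ∀ u, combinerLin a ξ (ε u) w = 0) : w = 0 := by
  have h1 : (combinerMatrix a ξ ε).mulVec (fun q => w q.1 q.2) = 0 := by
    funext p
    rw [combinerMatrix_mulVec]
    exact congrFun (h p.2) p.1
  have h2 := Matrix.eq_zero_of_mulVec_eq_zero hdet h1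
  funext M β
  exact congrFun h2 (M, β)

end ExtensionData

/-- Linear maps over `F` from which an aggregation scheme with `K` users is built: `share V k`
gives the part of the input of user `k` masked by a key of the group `V`, and `combine j` what
user `j` reveals of the sum. -/
structure LinearCode (F : Type u) [Field F] (K U S L p c : ℕ) where
  share : UserGroup K S → Fin K → (Fin L → F) →ₗ[F] (Fin p → F)
  combine : Fin K → (Fin L → F) →ₗ[F] (Fin c → F)
  recover : Fin K → Fin K → UserGroup K S → (Fin p → F) →ₗ[F] (Fin c → F)
  recover_eq_zero : ∀ j k V, ¬ (j ∈ V.1 ∧ k ∈ V.1) → recover j k V = 0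
  combine_eq : ∀ j k, j ≠ k → ∀ w, combine j w = ∑ V, recover j k V (share V k w)
  injective : ∀ U₂ : Finset (Fin K), U ≤ U₂.card → ∀ w, (∀ j ∈ U₂, combine j w = 0) → w = 0

/-- With d the number of hit sets and m the degree of E over F, an input is d U symbols of E, a
share U symbols and a combiner d symbols. Restriction of scalars multiplies each count by m. -/
theorem exists_linearCode (F : Type u) [Field F] [Fintype F] {K U S : ℕ} (hU : 1 ≤ U)
    (hUK : U < K) (hS : 2 ≤ S) (m₀ : ℕ) :
    ∃ m, m₀ ≤ m ∧ Nonempty (LinearCode F K U S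
      (((K - 1).choose (S - 1) - (K - 1 - U).choose (S - 1)) * (U * m)) (U * m)
      (((K - 1).choose (S - 1) - (K - 1 - U).choose (S - 1)) * m)) := by
  classical
  have : NeZero U := ⟨by omega⟩
  obtain ⟨t, rfl⟩ : ∃ t, S = t + 2 := ⟨S - 2, by omega⟩
  obtain ⟨r, hK⟩ : ∃ r, K = U + r + 1 := ⟨K - 1 - U, by omega⟩
  obtain ⟨E, _, _, _, hm, x, hx, ξ, hξ⟩ := exists_extension F K U r t m₀
  refine ⟨finrank F E, hm, ?_⟩
  set m := finrank F E with hmdef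
  set d := (K - 1).choose (t + 2 - 1) - (K - 1 - U).choose (t + 2 - 1) with hd
  have hdcard : Fintype.card (HitSet U r (t + 1)) = d := by
    rw [card_hitSet, hd, hK]
    congr 2
    omega
  let eW : (HitSet U r (t + 1) → Fin U → E) ≃ₗ[F] (Fin (d * (U * m)) → F) :=
    LinearEquiv.ofFinrankEq _ _ (by simp [Module.finrank_pi_fintype, hdcard, ← hmdef])
  let eB : (Fin U → E) ≃ₗ[F] (Fin (U * m) → F) :=
    LinearEquiv.ofFinrankEq _ _ (by simp [Module.finrank_pi_fintype, ← hmdef])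
  let eC : (HitSet U r (t + 1) → E) ≃ₗ[F] (Fin (d * m) → F) :=
    LinearEquiv.ofFinrankEq _ _ (by simp [Module.finrank_pi_fintype, hdcard, ← hmdef])
  let a : Fin K → Fin U ⊕ Fin r → E := powerVec x
  choose Λ hΛ using fun (j k : Fin K) (hjk : j ≠ k) =>
    exists_combiner_eq_sum_share a ξ hK hjk (linearIndependent_powerVec hx hK k)
  refine ⟨{
    share := fun V k => if hk : k ∈ V.1 then
        eB.toLinearMap ∘ₗ (shareLin a V k hk).restrictScalars F ∘ₗ eW.symm.toLinearMap else 0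
    combine := fun j =>
      eC.toLinearMap ∘ₗ (combinerLin a ξ j).restrictScalars F ∘ₗ eW.symm.toLinearMap
    recover := fun j k V => if h : j ≠ k ∧ j ∈ V.1 ∧ k ∈ V.1 then
      eC.toLinearMap ∘ₗ (Λ j k h.1 ⟨V, h.2⟩).restrictScalars F ∘ₗ eB.symm.toLinearMap else 0
    recover_eq_zero := fun j k V h => dif_neg fun h' => h h'.2
    combine_eq := fun j k hjk w => ?_
    injective := fun U₂ hU₂ w h => ?_ }⟩
  · simp only [LinearMap.comp_apply, LinearMap.restrictScalars_apply, LinearEquiv.coe_coe]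
    rw [hΛ j k hjk, map_sum]
    rw [← Finset.sum_subset (s₁ := Finset.univ.filter
      fun V : UserGroup K (t + 2) => j ∈ V.1 ∧ k ∈ V.1) (Finset.subset_univ _),
      Finset.sum_subtype (p := fun V : UserGroup K (t + 2) => j ∈ V.1 ∧ k ∈ V.1) _ (by simp)]
    · refine Finset.sum_congr rfl fun V _ => ?_
      rw [dif_pos ⟨hjk, V.2⟩, dif_pos V.2.2]
      simp
    · intro V _ hV
      rw [dif_neg fun h => hV (by simpa using h.2)]
      simp
  · obtain ⟨J, hJ, hJU⟩ := Finset.exists_subset_card_eq hU₂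
    have h0 : eW.symm w = 0 := by
      refine eq_zero_of_combinerLin_eq_zero (hξ _ (enum_injective (h := hJU))) fun u => ?_
      have := h _ (hJ (enum_mem (h := hJU) u))
      simpa using this
    simpa using h0

/-! ### Entropy of additive maps on a uniform space, and counting of groups. -/

lemma measurableFibers_of_discrete {Ω α : Type*} [MeasurableSpace Ω] [DiscreteMeasurableSpace Ω]
    (A : Ω → α) : MeasurableFibers A := fun _ => .of_discrete

section Uniform

variable {Ω α : Type*} [MeasurableSpace Ω] [DiscreteMeasurableSpace Ω] [Fintype Ω]
  [AddCommGroup Ω] [Fintype α] [AddCommGroup α]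

/-- An additive surjection from a uniform variable is uniform. -/
lemma uniformOn_real_fiber {A : Ω → α} (hadd : ∀ ω ω', A (ω + ω') = A ω + A ω')
    (hA : Function.Surjective A) (a : α) :
    (ProbabilityTheory.uniformOn (Set.univ : Set Ω)).real (A ⁻¹' {a}) =
      1 / Fintype.card α := by
  classical
  have : IsProbabilityMeasure (ProbabilityTheory.uniformOn (Set.univ : Set Ω)) :=
    ProbabilityTheory.isProbabilityMeasure_uniformOn Set.finite_univ Set.univ_nonempty
  have hshift : ∀ a a', (ProbabilityTheory.uniformOn (Set.univ : Set Ω)).real (A ⁻¹' {a}) =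
      (ProbabilityTheory.uniformOn (Set.univ : Set Ω)).real (A ⁻¹' {a'}) := by
    intro a a'
    have hcount : ∀ a, (ProbabilityTheory.uniformOn (Set.univ : Set Ω)).real (A ⁻¹' {a}) =
        (Finset.univ.filter fun ω => A ω = a).card / Fintype.card Ω := by
      intro a
      have he : A ⁻¹' {a} = ((Finset.univ.filter fun ω => A ω = a : Finset Ω) : Set Ω) := by
        ext ω; simp
      rw [Measure.real, ProbabilityTheory.uniformOn_univ, he, Measure.count_apply_finset]
      simp
    rw [hcount, hcount]
    have := AddMonoidHom.card_fiber_eq_of_mem_range (AddMonoidHom.mk' A hadd)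
      (x := a) (y := a') (hA a) (hA a')
    simp only [AddMonoidHom.mk'_apply] at this
    rw [this]
  have hsum := sum_measureReal_preimage (μ := ProbabilityTheory.uniformOn (Set.univ : Set Ω))
    (measurableFibers_of_discrete A)
  rw [Finset.sum_congr rfl fun a' _ => hshift a' a, Finset.sum_const, Finset.card_univ,
    nsmul_eq_mul] at hsum
  have : Nonempty α := ⟨0⟩
  have hpos : (0 : ℝ) < Fintype.card α := by exact_mod_cast Fintype.card_pos
  field_simp
  linarith

lemma entropy_of_additive_surjective (F : Type*) [Field F] [Fintype F] [Module F α]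
    {A : Ω → α} (hadd : ∀ ω ω', A (ω + ω') = A ω + A ω') (hA : Function.Surjective A) :
    entropy (Fintype.card F) (ProbabilityTheory.uniformOn (Set.univ : Set Ω)) A =
      finrank F α := by
  have hlog := Real.log_pos (Scheme.one_lt_card (F := F))
  have : Nonempty α := ⟨0⟩
  have hpos : (0 : ℝ) < Fintype.card α := by exact_mod_cast Fintype.card_pos
  have hcard : Real.log (Fintype.card α) = finrank F α * Real.log (Fintype.card F) := by
    rw [Module.card_eq_pow_finrank (K := F) (V := α), Nat.cast_pow, Real.log_pow]
  unfold entropy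
  simp only [uniformOn_real_fiber hadd hA, Finset.sum_const, Finset.card_univ, nsmul_eq_mul,
    Real.negMulLog, one_div, Real.log_inv, hcard]
  field_simp

end Uniform

section EntropyEq

variable {Ω α β : Type*} [MeasurableSpace Ω] [Fintype α] [Fintype β] {μ : Measure Ω}
  [IsProbabilityMeasure μ] {b : ℝ}

lemma entropy_congr (hb : 1 ≤ b) {A : Ω → α} {B : Ω → β} (hA : MeasurableFibers A)
    (hB : MeasurableFibers B) (hAB : A.FactorsThrough B) (hBA : B.FactorsThrough A) :
    entropy b μ A = entropy b μ B :=
  le_antisymm (entropy_mono hb hB hAB) (entropy_mono hb hA hBA)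

lemma condEntropy_eq_zero_of_factorsThrough (hb : 1 ≤ b) {A : Ω → α} {B : Ω → β}
    (hA : MeasurableFibers A) (hB : MeasurableFibers B) (h : A.FactorsThrough B) :
    condEntropy b μ A B = 0 :=
  sub_eq_zero.2 (entropy_congr hb (hA.prodMk hB) hB (fun _ _ e => Prod.ext (h e) e)
    (fun _ _ e => congrArg Prod.snd e))

end EntropyEq

lemma card_groups_of_mem {K S : ℕ} (hS : 1 ≤ S) (k : Fin K) :
    Fintype.card {V : UserGroup K S // k ∈ V.1} = (K - 1).choose (S - 1) := by
  have h1 : ((Finset.univ.erase k).powersetCard (S - 1)).card = (K - 1).choose (S - 1) := by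
    rw [Finset.card_powersetCard, Finset.card_erase_of_mem (Finset.mem_univ k), Finset.card_univ,
      Fintype.card_fin]
  rw [← h1, ← Fintype.card_coe]
  refine Fintype.card_congr
    { toFun := fun V => ⟨V.1.1.erase k, Finset.mem_powersetCard.2
        ⟨Finset.erase_subset_erase _ (Finset.subset_univ _), by
          rw [Finset.card_erase_of_mem V.2, V.1.2]⟩⟩
      invFun := fun T => ⟨⟨insert k T.1, by
          have := Finset.mem_powersetCard.1 T.2
          rw [Finset.card_insert_of_notMem fun h => by simpa using this.1 h, this.2]
          omega⟩, Finset.mem_insert_self _ _⟩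
      left_inv := fun V => Subtype.ext (Subtype.ext (Finset.insert_erase V.2))
      right_inv := fun T => Subtype.ext (Finset.erase_insert fun h => by
        simpa using (Finset.mem_powersetCard.1 T.2).1 h) }

lemma exists_group_mem {K S : ℕ} (hS : 1 ≤ S) (hSK : S ≤ K) (k : Fin K) :
    ∃ V : UserGroup K S, k ∈ V.1 := by
  have h := card_groups_of_mem hS k
  have : 0 < Fintype.card {V : UserGroup K S // k ∈ V.1} := by
    rw [h]; exact Nat.choose_pos (by omega)
  obtain ⟨V⟩ := Fintype.card_pos_iff.1 this
  exact ⟨V.1, V.2⟩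

/-! ### The scheme built from a linear code. -/

namespace LinearCode

set_option linter.unusedSectionVars false

variable {F : Type u} [Field F] [Fintype F] {K U S L p c : ℕ}

/-- The alphabet of the keys: for each user a mask, and padding for the two rounds. -/
abbrev KeySpace (F : Type u) (K p e₁ e₂ : ℕ) : Type u :=
  (Fin K → Fin p → F) × (Fin K → Fin e₁ → F) × (Fin K → Fin e₂ → F)

/-- The sample space: all inputs and all keys. -/
abbrev Space (F : Type u) (K S L p e₁ e₂ : ℕ) : Type u :=
  (Fin K → Fin L → F) × (UserGroup K S → KeySpace F K p e₁ e₂)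

instance (e₁ e₂ : ℕ) : MeasurableSpace (Space F K S L p e₁ e₂) := ⊤

instance (e₁ e₂ : ℕ) : DiscreteMeasurableSpace (Space F K S L p e₁ e₂) := ⟨fun _ => trivial⟩

instance (e₁ e₂ : ℕ) : IsProbabilityMeasure
    (ProbabilityTheory.uniformOn (Set.univ : Set (Space F K S L p e₁ e₂))) :=
  ProbabilityTheory.isProbabilityMeasure_uniformOn Set.finite_univ ⟨0, Set.mem_univ 0⟩

variable (𝒞 : LinearCode F K U S L p c) (e₁ e₂ : ℕ) (grp : Fin K → UserGroup K S)

/-- First-round message: the shares of the input, each masked by the key of its group, and the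
padding. -/
def msg₁ (k : Fin K) (ω : Space F K S L p e₁ e₂) :
    ({V : UserGroup K S // k ∈ V.1} → Fin p → F) × (Fin e₁ → F) :=
  (fun V => 𝒞.share V.1 k (ω.1 k) + (ω.2 V.1).1 k, (ω.2 (grp k)).2.1 k)

/-- Second-round message: what user `j` has to add to the first-round messages of the others to
reveal its combination of the sum, and the padding. -/
def msg₂ (U₁ : Finset (Fin K)) (j : Fin K) (ω : Space F K S L p e₁ e₂) :
    (Fin c → F) × (Fin e₂ → F) :=
  (𝒞.combine j (ω.1 j) - ∑ k ∈ U₁.erase j, ∑ V, 𝒞.recover j k V ((ω.2 V).1 k),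
    (ω.2 (grp j)).2.2 j)

/-- The aggregation scheme defined by a linear code. -/
noncomputable def scheme : Scheme K S L F where
  Ω := Space F K S L p e₁ e₂
  μ := ProbabilityTheory.uniformOn Set.univ
  Key _ := KeySpace F K p e₁ e₂
  Msg₁ k := ({V : UserGroup K S // k ∈ V.1} → Fin p → F) × (Fin e₁ → F)
  Msg₂ _ _ := (Fin c → F) × (Fin e₂ → F)
  W k ω := ω.1 k
  Z V ω := ω.2 V
  X := 𝒞.msg₁ e₁ e₂ grp
  Y := 𝒞.msg₂ e₁ e₂ grp
  measurable_W _ := fun _ _ => trivial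
  measurable_Z _ := fun _ _ => trivial
  measurable_X _ := fun _ _ => trivial
  measurable_Y _ _ := fun _ _ => trivial

instance : DiscreteMeasurableSpace (𝒞.scheme e₁ e₂ grp).Ω :=
  inferInstanceAs (DiscreteMeasurableSpace (Space F K S L p e₁ e₂))

variable {e₁ e₂ grp}

lemma msg₁_add (k : Fin K) (ω ω' : Space F K S L p e₁ e₂) :
    𝒞.msg₁ e₁ e₂ grp k (ω + ω') = 𝒞.msg₁ e₁ e₂ grp k ω + 𝒞.msg₁ e₁ e₂ grp k ω' := by
  refine Prod.ext (funext fun V => ?_) rfl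
  simp only [msg₁, Prod.fst_add, Prod.snd_add, Pi.add_apply, map_add]
  abel

lemma msg₂_add (U₁ : Finset (Fin K)) (j : Fin K) (ω ω' : Space F K S L p e₁ e₂) :
    𝒞.msg₂ e₁ e₂ grp U₁ j (ω + ω') =
      𝒞.msg₂ e₁ e₂ grp U₁ j ω + 𝒞.msg₂ e₁ e₂ grp U₁ j ω' := by
  refine Prod.ext ?_ rfl
  simp only [msg₂, Prod.fst_add, Prod.snd_add, Pi.add_apply, map_add, Finset.sum_add_distrib]
  abel

/-- The server's combination of the sum in terms of the messages. -/
lemma combine_sum {U₁ : Finset (Fin K)} {j : Fin K} (hj : j ∈ U₁) (ω : Space F K S L p e₁ e₂) :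
    𝒞.combine j (∑ k ∈ U₁, ω.1 k) = (𝒞.msg₂ e₁ e₂ grp U₁ j ω).1 +
      ∑ k ∈ U₁.erase j, ∑ V, if h : k ∈ V.1 then
        𝒞.recover j k V ((𝒞.msg₁ e₁ e₂ grp k ω).1 ⟨V, h⟩) else 0 := by
  have h1 : ∀ k ∈ U₁.erase j, (∑ V, if h : k ∈ V.1 then
      𝒞.recover j k V ((𝒞.msg₁ e₁ e₂ grp k ω).1 ⟨V, h⟩) else 0) =
      𝒞.combine j (ω.1 k) + ∑ V, 𝒞.recover j k V ((ω.2 V).1 k) := by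
    intro k hk
    rw [𝒞.combine_eq j k (Finset.ne_of_mem_erase hk).symm, ← Finset.sum_add_distrib]
    refine Finset.sum_congr rfl fun V _ => ?_
    split_ifs with h
    · rw [← map_add]; rfl
    · rw [𝒞.recover_eq_zero j k V fun h' => h h'.2]; simp
  rw [Finset.sum_congr rfl h1, Finset.sum_add_distrib, ← Finset.add_sum_erase _ _ hj, map_add,
    map_sum]
  simp only [msg₂]
  abel

/-- The combiners of `U` users containing `j` map injectively between spaces of equal dimension L =
U c, so they are jointly onto. This makes the second-round message uniform and its rate exact. -/
lemma combine_surjective (hL : L = U * c) (hU : 1 ≤ U) (hUK : U < K) (j : Fin K) :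
    Function.Surjective (𝒞.combine j) := by
  obtain ⟨U₂, hj, hU₂⟩ : ∃ U₂ : Finset (Fin K), j ∈ U₂ ∧ U₂.card = U := by
    obtain ⟨U₂, h1, -, h2⟩ := Finset.exists_subsuperset_card_eq (Finset.subset_univ {j})
      (by simpa using hU) (n := U) (by simpa using hUK.le)
    exact ⟨U₂, by simpa using h1, h2⟩
  let φ : (Fin L → F) →ₗ[F] (U₂ → Fin c → F) := LinearMap.pi fun i => 𝒞.combine i
  have hinj : Function.Injective φ := by
    rw [← LinearMap.ker_eq_bot, LinearMap.ker_eq_bot']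
    intro w hw
    exact 𝒞.injective U₂ hU₂.ge w fun i hi => congrFun hw ⟨i, hi⟩
  have hsurj : Function.Surjective φ :=
    (LinearMap.injective_iff_surjective_of_finrank_eq_finrank
      (by simp [Module.finrank_pi_fintype, hU₂, hL])).1 hinj
  intro y
  obtain ⟨w, hw⟩ := hsurj (fun _ => y)
  exact ⟨w, congrFun hw ⟨j, hj⟩⟩

/-- The inputs, the first-round messages and the second-round padding are jointly uniform. -/
lemma exists_sample (w : Fin K → Fin L → F)
    (x : ∀ k : Fin K, ({V : UserGroup K S // k ∈ V.1} → Fin p → F) × (Fin e₁ → F))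
    (z : Fin K → Fin e₂ → F) :
    ∃ ω : Space F K S L p e₁ e₂, ω.1 = w ∧ (∀ k, 𝒞.msg₁ e₁ e₂ grp k ω = x k) ∧
      ∀ k, (ω.2 (grp k)).2.2 k = z k := by
  classical
  refine ⟨(w, fun V => (fun k => if h : k ∈ V.1 then (x k).1 ⟨V, h⟩ - 𝒞.share V k (w k) else 0,
    fun k => (x k).2, z)), rfl, fun k => Prod.ext (funext fun V => ?_) rfl, fun k => rfl⟩
  simp [msg₁, V.2]

lemma H_msg₁ (hS : 1 ≤ S) (k : Fin K) :
    (𝒞.scheme e₁ e₂ grp).H ((𝒞.scheme e₁ e₂ grp).X k) = (K - 1).choose (S - 1) * p + e₁ := by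
  have h := entropy_of_additive_surjective F (𝒞.msg₁_add (grp := grp) (e₁ := e₁) (e₂ := e₂) k)
    (fun x => by
      obtain ⟨ω, -, h, -⟩ := 𝒞.exists_sample (grp := grp) (e₁ := e₁) (e₂ := e₂) 0
        (Function.update 0 k x) 0
      exact ⟨ω, by rw [h k, Function.update_self]⟩)
  refine h.trans ?_
  simp [Module.finrank_prod, Module.finrank_pi_fintype, card_groups_of_mem hS]

lemma H_msg₂ (hL : L = U * c) (hU : 1 ≤ U) (hUK : U < K) (U₁ : Finset (Fin K)) (j : Fin K) :
    (𝒞.scheme e₁ e₂ grp).H ((𝒞.scheme e₁ e₂ grp).Y U₁ j) = c + e₂ := by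
  have h := entropy_of_additive_surjective F
    (𝒞.msg₂_add (grp := grp) (e₁ := e₁) (e₂ := e₂) U₁ j)
    (fun y => by
      obtain ⟨w, hw⟩ := 𝒞.combine_surjective hL hU hUK j y.1
      exact ⟨(fun _ => w, fun _ => (0, 0, fun _ => y.2)), by
        refine Prod.ext ?_ rfl
        simp [msg₂, hw]⟩)
  refine h.trans ?_
  simp [Module.finrank_prod]

theorem isSecureAggregation (hU : 1 ≤ U) (hgrp : ∀ k, k ∈ (grp k).1) :
    (𝒞.scheme e₁ e₂ grp).IsSecureAggregation U := by
  have hb := Scheme.one_le_card (F := F)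
  have hW : ∀ k : Fin K, Function.Surjective (fun ω : Space F K S L p e₁ e₂ => ω.1 k) :=
    fun k w => ⟨(fun _ => w, 0), rfl⟩
  have hWent : ∀ k : Fin K, (𝒞.scheme e₁ e₂ grp).H ((𝒞.scheme e₁ e₂ grp).W k) = L :=
    fun k => (entropy_of_additive_surjective F (fun _ _ => rfl) (hW k)).trans (by simp)
  refine ⟨?_, ?_, ?_, ?_, ?_, ?_⟩
  · intro k w
    refine (uniformOn_real_fiber (fun _ _ => rfl) (hW k) w).trans ?_
    simp
  · have hZ : ∀ V, (𝒞.scheme e₁ e₂ grp).H ((𝒞.scheme e₁ e₂ grp).Z V) =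
        finrank F (KeySpace F K p e₁ e₂) := fun V =>
      entropy_of_additive_surjective F (A := fun ω : Space F K S L p e₁ e₂ => ω.2 V)
        (fun _ _ => rfl) (fun z => ⟨(0, fun _ => z), rfl⟩)
    have hall := entropy_of_additive_surjective F
      (A := fun ω : Space F K S L p e₁ e₂ => ((fun V => ω.2 V), (fun k => ω.1 k)))
      (fun _ _ => rfl) (fun z => ⟨(z.2, z.1), rfl⟩)
    refine hall.trans ?_
    rw [Finset.sum_congr rfl fun V _ => hZ V, Finset.sum_congr rfl fun k _ => hWent k]
    rw [Module.finrank_prod, Module.finrank_pi_fintype, Module.finrank_pi_fintype]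
    simp
    ring
  · intro k
    refine condEntropy_eq_zero_of_factorsThrough hb (measurableFibers_of_discrete _)
      (measurableFibers_of_discrete _) fun ω ω' e => ?_
    obtain ⟨e1, e2⟩ := Prod.mk.inj e
    have e2' : ∀ V : UserGroup K S, k ∈ V.1 → ω.2 V = ω'.2 V := fun V hV => congrFun e2 ⟨V, hV⟩
    have e1' : ω.1 k = ω'.1 k := e1
    change 𝒞.msg₁ e₁ e₂ grp k ω = 𝒞.msg₁ e₁ e₂ grp k ω'
    refine Prod.ext (funext fun V => ?_) ?_
    · simp only [msg₁, e1', e2' V.1 V.2]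
    · simp only [msg₁, e2' _ (hgrp k)]
  · intro U₁ _ j _
    refine condEntropy_eq_zero_of_factorsThrough hb (measurableFibers_of_discrete _)
      (measurableFibers_of_discrete _) fun ω ω' e => ?_
    obtain ⟨e1, e2⟩ := Prod.mk.inj e
    have e2' : ∀ V : UserGroup K S, j ∈ V.1 → ω.2 V = ω'.2 V := fun V hV => congrFun e2 ⟨V, hV⟩
    have e1' : ω.1 j = ω'.1 j := e1
    change 𝒞.msg₂ e₁ e₂ grp U₁ j ω = 𝒞.msg₂ e₁ e₂ grp U₁ j ω'
    refine Prod.ext ?_ ?_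
    · simp only [msg₂, e1']
      congr 1
      refine Finset.sum_congr rfl fun k _ => Finset.sum_congr rfl fun V _ => ?_
      by_cases hV : j ∈ V.1
      · rw [e2' V hV]
      · rw [𝒞.recover_eq_zero j k V fun h => hV h.1]; rfl
    · simp only [msg₂, e2' _ (hgrp j)]
  · intro U₁ U₂ hsub hU₂
    refine condEntropy_eq_zero_of_factorsThrough hb (measurableFibers_of_discrete _)
      (measurableFibers_of_discrete _) fun ω ω' e => ?_
    obtain ⟨e1, e2⟩ := Prod.mk.inj e
    have e1' : ∀ k ∈ U₁, 𝒞.msg₁ e₁ e₂ grp k ω = 𝒞.msg₁ e₁ e₂ grp k ω' :=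
      fun k hk => congrFun e1 ⟨k, hk⟩
    have e2' : ∀ k ∈ U₂, 𝒞.msg₂ e₁ e₂ grp U₁ k ω = 𝒞.msg₂ e₁ e₂ grp U₁ k ω' :=
      fun k hk => congrFun e2 ⟨k, hk⟩
    change ∑ k ∈ U₁, ω.1 k = ∑ k ∈ U₁, ω'.1 k
    -- By `combine_sum`, the received messages fix the combiner values of the sum for all of `U₂`,
    -- and those values determine the sum.
    refine sub_eq_zero.1 (𝒞.injective U₂ hU₂ _ fun j hj => ?_)
    rw [map_sub, sub_eq_zero, 𝒞.combine_sum (grp := grp) (hsub hj) ω,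
      𝒞.combine_sum (grp := grp) (hsub hj) ω', e2' j hj]
    congr 1
    exact Finset.sum_congr rfl fun k hk => by rw [e1' k (Finset.mem_of_mem_erase hk)]
  · intro U₁ hU₁
    obtain ⟨i, hi⟩ : U₁.Nonempty := Finset.card_pos.1 (by omega)
    -- all messages are equivalent to `R` once the sum is known
    let R : Space F K S L p e₁ e₂ →
        (∀ k : Fin K, ({V : UserGroup K S // k ∈ V.1} → Fin p → F) × (Fin e₁ → F)) ×
          (U₁ → Fin e₂ → F) :=
      fun ω => ((fun k => 𝒞.msg₁ e₁ e₂ grp k ω), fun j => (ω.2 (grp j)).2.2 j)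
    let T : Space F K S L p e₁ e₂ → Fin L → F := fun ω => ∑ k ∈ U₁, ω.1 k
    let M : Space F K S L p e₁ e₂ →
        (∀ k : Fin K, ({V : UserGroup K S // k ∈ V.1} → Fin p → F) × (Fin e₁ → F)) ×
          (U₁ → (Fin c → F) × (Fin e₂ → F)) :=
      fun ω => ((fun k => 𝒞.msg₁ e₁ e₂ grp k ω), fun j => 𝒞.msg₂ e₁ e₂ grp U₁ j ω)
    let W : Space F K S L p e₁ e₂ → Fin K → Fin L → F := fun ω => ω.1
    have hTW : ∀ ω ω', W ω = W ω' → T ω = T ω' := fun ω ω' e => by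
      change ∑ k ∈ U₁, W ω k = ∑ k ∈ U₁, W ω' k
      rw [e]
    have hMR : ∀ ω ω', M ω = M ω' → R ω = R ω' := fun ω ω' e => by
      obtain ⟨h1, h2⟩ := Prod.mk.inj e
      exact Prod.ext h1 (funext fun j => congrArg Prod.snd (congrFun h2 j))
    have hRM : ∀ ω ω', R ω = R ω' → T ω = T ω' → M ω = M ω' := fun ω ω' e eT => by
      obtain ⟨h1, h2⟩ := Prod.mk.inj e
      refine Prod.ext h1 (funext fun j => Prod.ext ?_ (congrFun h2 j))
      have k1 := 𝒞.combine_sum (grp := grp) (e₁ := e₁) (e₂ := e₂) j.2 ω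
      have k2 := 𝒞.combine_sum (grp := grp) (e₁ := e₁) (e₂ := e₂) j.2 ω'
      rw [show ∑ k ∈ U₁, ω.1 k = ∑ k ∈ U₁, ω'.1 k from eT, k2] at k1
      have k3 : ∀ k, 𝒞.msg₁ e₁ e₂ grp k ω = 𝒞.msg₁ e₁ e₂ grp k ω' := fun k => congrFun h1 k
      simp only [k3] at k1
      exact (add_right_cancel k1).symm
    have hRadd : ∀ ω ω', R (ω + ω') = R ω + R ω' := fun ω ω' =>
      Prod.ext (funext fun k => 𝒞.msg₁_add k ω ω') rfl
    have hTadd : ∀ ω ω', T (ω + ω') = T ω + T ω' := fun ω ω' => Finset.sum_add_distrib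
    have hWR : ∀ w x z, ∃ ω, W ω = w ∧ R ω = (x, z) := by
      intro w x z
      obtain ⟨ω, h1, h2, h3⟩ := 𝒞.exists_sample (grp := grp) (e₁ := e₁) (e₂ := e₂) w x
        (fun k => if h : k ∈ U₁ then z ⟨k, h⟩ else 0)
      refine ⟨ω, h1, Prod.ext (funext h2) (funext fun j => (h3 j).trans ?_)⟩
      simp
    set μ := ProbabilityTheory.uniformOn (Set.univ : Set (Space F K S L p e₁ e₂))
    set q : ℝ := (Fintype.card F : ℝ)
    have n1 : entropy q μ (fun ω => (W ω, T ω)) = entropy q μ W :=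
      entropy_congr hb (measurableFibers_of_discrete _) (measurableFibers_of_discrete _)
        (fun ω ω' e => Prod.ext e (hTW ω ω' e)) (fun ω ω' e => (Prod.mk.inj e).1)
    have n2 : entropy q μ (fun ω => (W ω, M ω, T ω)) = entropy q μ (fun ω => (W ω, R ω)) :=
      entropy_congr hb (measurableFibers_of_discrete _) (measurableFibers_of_discrete _)
        (fun ω ω' e => by
          obtain ⟨h1, h2⟩ := Prod.mk.inj e
          have := hTW ω ω' h1
          exact Prod.ext h1 (Prod.ext (hRM ω ω' h2 this) this))
        (fun ω ω' e => by
          obtain ⟨h1, h2⟩ := Prod.mk.inj e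
          exact Prod.ext h1 (hMR ω ω' (congrArg Prod.fst h2)))
    have n3 : entropy q μ (fun ω => (M ω, T ω)) = entropy q μ (fun ω => (R ω, T ω)) :=
      entropy_congr hb (measurableFibers_of_discrete _) (measurableFibers_of_discrete _)
        (fun ω ω' e => by
          obtain ⟨h1, h2⟩ := Prod.mk.inj e
          exact Prod.ext (hRM ω ω' h1 h2) h2)
        (fun ω ω' e => by
          obtain ⟨h1, h2⟩ := Prod.mk.inj e
          exact Prod.ext (hMR ω ω' h1) h2)
    have hsingle : ∀ s : Fin L → F, ∑ k ∈ U₁, (Pi.single i s : Fin K → Fin L → F) k = s := by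
      intro s
      rw [Finset.sum_eq_single i (fun k _ hk => by simp [hk]) fun h => absurd hi h,
        Pi.single_eq_same]
    have v1 : entropy q μ W = finrank F (Fin K → Fin L → F) :=
      entropy_of_additive_surjective F (fun _ _ => rfl) (fun w => ⟨(w, 0), rfl⟩)
    have v2 : entropy q μ T = finrank F (Fin L → F) :=
      entropy_of_additive_surjective F hTadd
        (fun s => ⟨(Pi.single i s, 0), hsingle s⟩)
    have v3 := entropy_of_additive_surjective F (A := fun ω => (W ω, R ω))
      (fun ω ω' => Prod.ext rfl (hRadd ω ω')) (fun y => by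
        obtain ⟨ω, h1, h2⟩ := hWR y.1 y.2.1 y.2.2
        exact ⟨ω, Prod.ext h1 h2⟩)
    have v4 := entropy_of_additive_surjective F (A := fun ω => (R ω, T ω))
      (fun ω ω' => Prod.ext (hRadd ω ω') (hTadd ω ω')) (fun y => by
        obtain ⟨ω, h1, h2⟩ := hWR (Pi.single i y.2) y.1.1 y.1.2
        refine ⟨ω, Prod.ext h2 ?_⟩
        change ∑ k ∈ U₁, W ω k = y.2
        rw [h1, hsingle])
    -- Every entropy is now a dimension. With ρ the dimension of the range of `R`, the security
    -- expression is (K L - L) - ((K L + ρ) - (ρ + L)) = 0.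
    rw [Module.finrank_prod, Nat.cast_add] at v3 v4
    change (entropy q μ (fun ω => (W ω, T ω)) - entropy q μ T) -
      (entropy q μ (fun ω => (W ω, M ω, T ω)) - entropy q μ (fun ω => (M ω, T ω))) = 0
    rw [n1, n2, n3, v1, v2, v3, v4]
    ring

end LinearCode

/-! ### Rate pairs and the capacity region. -/

lemma choose_lt_choose_of_lt {r n s : ℕ} (hs : 1 ≤ s) (hsn : s ≤ n) (hrn : r < n) :
    r.choose s < n.choose s := by
  rcases lt_or_ge r s with h | h
  · rw [Nat.choose_eq_zero_of_lt h]
    exact Nat.choose_pos hsn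
  · refine lt_of_lt_of_le ?_ (Nat.choose_le_choose s (show r + 1 ≤ n from hrn))
    obtain ⟨s, rfl⟩ : ∃ s', s = s' + 1 := ⟨s - 1, by omega⟩
    rw [Nat.choose_succ_succ']
    have : 0 < r.choose s := Nat.choose_pos (by omega)
    omega

/-- Achievability, with arbitrary padding of both rates. -/
theorem exists_achievable (F : Type u) [Field F] [Fintype F] {K U S : ℕ} (hU : 1 ≤ U)
    (hUK : U < K) (hS : 2 ≤ S) (hSK : S ≤ K) (L₀ : ℕ) :
    ∃ L : ℕ, 0 < L ∧ L₀ ≤ L ∧ ∀ e₁ e₂ : ℕ, Achievable K U S F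
      (((K - 1).choose (S - 1) : ℝ) /
        (((K - 1).choose (S - 1) : ℝ) - ((K - 1 - U).choose (S - 1) : ℝ)) + e₁ / L,
        1 / (U : ℝ) + e₂ / L) := by
  -- The degree m ≥ L₀ + 1 is positive and at most L = d U m, so the resulting input length is
  -- nonzero and at least L₀.
  obtain ⟨m, hm, ⟨𝒞⟩⟩ := exists_linearCode F hU hUK hS (L₀ + 1)
  choose grp hgrp using exists_group_mem (K := K) (S := S) (by omega) hSK
  have hlt : (K - 1 - U).choose (S - 1) < (K - 1).choose (S - 1) :=
    choose_lt_choose_of_lt (by omega) (by omega) (by omega)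
  have hsub : (((K - 1).choose (S - 1) - (K - 1 - U).choose (S - 1) : ℕ) : ℝ) =
      ((K - 1).choose (S - 1) : ℝ) - ((K - 1 - U).choose (S - 1) : ℝ) := Nat.cast_sub hlt.le
  rw [← hsub]
  have hd : 0 < (K - 1).choose (S - 1) - (K - 1 - U).choose (S - 1) := by omega
  set d := (K - 1).choose (S - 1) - (K - 1 - U).choose (S - 1)
  have hm0 : 0 < m := by omega
  have hdR : (0 : ℝ) < d := by exact_mod_cast hd
  have hmR : (0 : ℝ) < m := by exact_mod_cast hm0
  have hUR : (0 : ℝ) < U := by exact_mod_cast hU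
  refine ⟨d * (U * m), by positivity, ?_, fun e₁ e₂ => ⟨d * (U * m), by positivity,
    𝒞.scheme e₁ e₂ grp, 𝒞.isSecureAggregation hU hgrp, ?_, ?_⟩⟩
  · calc L₀ ≤ m := by omega
      _ ≤ d * (U * m) := Nat.le_mul_of_pos_left _ hd |>.trans' (Nat.le_mul_of_pos_left _ hU)
  · have : Nonempty (Fin K) := ⟨⟨0, by omega⟩⟩
    rw [Scheme.rate₁]
    simp only [𝒞.H_msg₁ (show 1 ≤ S by omega)]
    rw [ciSup_const]
    push_cast
    field_simp
  · have : Nonempty {p : Finset (Fin K) × Fin K // U ≤ p.1.card ∧ p.2 ∈ p.1} :=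
      ⟨⟨(Finset.univ, ⟨0, by omega⟩), by simpa using hUK.le, Finset.mem_univ _⟩⟩
    rw [Scheme.rate₂]
    simp only [𝒞.H_msg₂ (by ring) hU hUK]
    rw [ciSup_const]
    push_cast
    field_simp

section CapacityRegion

variable {F : Type u} [Field F] [Fintype F] {K U S : ℕ}

/-- For S = 1 both binomial coefficients in the first-round bound equal 1, so it reads L ≤ 0. -/
theorem not_possible_of_singleton_groups (hU : 1 ≤ U) (hUK : U < K) :
    ¬ Possible K U 1 F := by
  rintro ⟨L, hL, 𝒮, h⟩
  have h1 := Scheme.le_mul_H_first h hU hUK le_rfl (by omega) ⟨0, by omega⟩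
  simp only [Nat.sub_self, Nat.choose_zero_right, Nat.cast_one, sub_self, zero_mul, one_mul] at h1
  have : (0 : ℝ) < L := by exact_mod_cast hL
  linarith

theorem rate_bounds_of_achievable (hU : 1 ≤ U) (hUK : U < K) (hS : 2 ≤ S) (hSK : S ≤ K)
    {R : ℝ × ℝ} (hR : Achievable K U S F R) :
    ((K - 1).choose (S - 1) : ℝ) /
        (((K - 1).choose (S - 1) : ℝ) - ((K - 1 - U).choose (S - 1) : ℝ)) ≤ R.1 ∧
      1 / (U : ℝ) ≤ R.2 := by
  obtain ⟨L, hL, 𝒮, h, h1, h2⟩ := hR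
  have hLR : (0 : ℝ) < L := by exact_mod_cast hL
  have hUR : (0 : ℝ) < U := by exact_mod_cast hU
  constructor
  · let k : Fin K := ⟨0, by omega⟩
    have hlt : (K - 1 - U).choose (S - 1) < (K - 1).choose (S - 1) :=
      choose_lt_choose_of_lt (by omega) (by omega) (by omega)
    have hd : (0 : ℝ) < ((K - 1).choose (S - 1) : ℝ) - ((K - 1 - U).choose (S - 1) : ℝ) :=
      sub_pos.2 (by exact_mod_cast hlt)
    have hk := Scheme.le_mul_H_first h hU hUK (by omega) hSK k
    rw [h1]
    refine le_trans ?_ (le_ciSup (f := fun k => 𝒮.H (𝒮.X k) / L) (Set.finite_range _).bddAbove k)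
    rw [div_le_div_iff₀ hd hLR]
    linarith
  · obtain ⟨U₁, -, hU₁⟩ := Finset.exists_subset_card_eq
      (s := (Finset.univ : Finset (Fin K))) (n := U) (by simpa using hUK.le)
    have hsum := Scheme.le_sum_H_second h hU hU₁ hUK
    have hle : ∀ k ∈ U₁, 𝒮.H (𝒮.Y U₁ k) ≤ L * R.2 := by
      intro k hk
      have := le_ciSup (f := fun p : {p : Finset (Fin K) × Fin K // U ≤ p.1.card ∧ p.2 ∈ p.1} =>
        𝒮.H (𝒮.Y p.1.1 p.1.2) / L) (Set.finite_range _).bddAbove ⟨(U₁, k), hU₁.ge, hk⟩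
      rw [h2, Scheme.rate₂]
      rw [div_le_iff₀ hLR] at this
      linarith
    have := hsum.trans (Finset.sum_le_sum hle)
    rw [Finset.sum_const, hU₁, nsmul_eq_mul] at this
    rw [div_le_iff₀ hUR]
    refine le_of_mul_le_mul_left ?_ hLR
    linarith

/-- Padding moves a rate along a grid of spacing 1/L. It is needed because an achievable pair
consists of the exact rates of a scheme, so that upward closure is not automatic. -/
lemma exists_nat_approx {a b ε : ℝ} {L : ℕ} (hab : a ≤ b) (hL : 0 < L) (hε : 1 / (L : ℝ) < ε) :
    ∃ e : ℕ, |b - (a + e / L)| < ε := by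
  have hLR : (0 : ℝ) < L := by exact_mod_cast hL
  refine ⟨⌊(b - a) * L⌋₊, ?_⟩
  have h1 := Nat.floor_le (mul_nonneg (sub_nonneg.2 hab) hLR.le)
  have h2 := Nat.lt_floor_add_one ((b - a) * L)
  have h3 : (⌊(b - a) * L⌋₊ : ℝ) / L ≤ b - a := by rwa [div_le_iff₀ hLR]
  have h4 : b - a < (⌊(b - a) * L⌋₊ : ℝ) / L + 1 / L := by
    rw [← add_div, lt_div_iff₀ hLR]; exact h2
  rw [abs_lt]
  constructor <;> linarith

theorem mem_capacityRegion (hU : 1 ≤ U) (hUK : U < K) (hS : 2 ≤ S) (hSK : S ≤ K)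
    {R : ℝ × ℝ} (h₁ : ((K - 1).choose (S - 1) : ℝ) /
        (((K - 1).choose (S - 1) : ℝ) - ((K - 1 - U).choose (S - 1) : ℝ)) ≤ R.1)
    (h₂ : 1 / (U : ℝ) ≤ R.2) : R ∈ capacityRegion K U S F := by
  refine Metric.mem_closure_iff.2 fun ε hε => ?_
  obtain ⟨L₀, hL₀⟩ := exists_nat_gt (1 / ε)
  obtain ⟨L, hL, hLL, hach⟩ := exists_achievable F hU hUK hS hSK L₀
  have hLR : (0 : ℝ) < L := by exact_mod_cast hL
  have hsmall : 1 / (L : ℝ) < ε := by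
    rw [div_lt_comm₀ hLR hε]
    exact hL₀.trans_le (by exact_mod_cast hLL)
  obtain ⟨e₁, he₁⟩ := exists_nat_approx h₁ hL hsmall
  obtain ⟨e₂, he₂⟩ := exists_nat_approx h₂ hL hsmall
  refine ⟨_, hach e₁ e₂, ?_⟩
  rw [Prod.dist_eq, max_lt_iff, Real.dist_eq, Real.dist_eq]
  exact ⟨he₁, he₂⟩

end CapacityRegion

end SecureAggregation

theorem theorem4 {F : Type*} [Field F] [Fintype F] (K U S : ℕ)
    (hU : 1 ≤ U) (hUK : U < K) (hSK : S ≤ K) :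
    (S = 1 → ¬ SecureAggregation.Possible K U S F) ∧
    (2 ≤ S →
      SecureAggregation.capacityRegion K U S F =
        {R : ℝ × ℝ |
          ((K - 1).choose (S - 1) : ℝ) /
              (((K - 1).choose (S - 1) : ℝ) - ((K - 1 - U).choose (S - 1) : ℝ)) ≤ R.1 ∧
          1 / (U : ℝ) ≤ R.2}) := by
  refine ⟨?_, fun hS => Set.Subset.antisymm ?_ ?_⟩
  · rintro rfl
    exact SecureAggregation.not_possible_of_singleton_groups hU hUK
  · refine closure_minimal
      (fun R hR => SecureAggregation.rate_bounds_of_achievable hU hUK hS hSK hR) ?_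
    exact (isClosed_le continuous_const continuous_fst).inter
      (isClosed_le continuous_const continuous_snd)
  · rintro R ⟨h₁, h₂⟩
    exact SecureAggregation.mem_capacityRegion hU hUK hS hSK h₁ h₂
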